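/- Let $n\ge 2$ and let $w\in\mathfrak S_n$ be fully supported, i.e. $\{w(1),\dots,w(r)\}\ne\{1,\dots,r\}$ for all $1\le r<n$. Elnitsky's polygon $X(w)$ is an equilateral $2n$-gon whose sides are labeled $1,\dots,n,w(n),\dots,w(1)$ in counterclockwise order starting from the top vertex, whose first $n$ sides form half of a centrally symmetric convex $2n$-gon, and in which sides with the same label are parallel; it is oriented so that the path with labels $1,\dots,n$ and the path with labels $w(1),\dots,w(n)$ both descend from the top vertex to the bottom vertex. A rhombic tiling of $X(w)$ is a tiling by rhombi whose edges are congruent and parallel to sides of $X(w)$, and the labels of a tile are the labels of the sides to which its edges are parallel. A tile is a top-perimeter tile if the two sides of $X(w)$ that meet at the top vertex are edges of it, and it is a forced top-perimeter tile for $w$ if it appears as a top-perimeter tile in every rhombic tiling of $X(w)$. Then the following are equivalent: (1) there is a forced top-perimeter tile for $w$; (2) $w(1)$ and $1$ do not appear together in a $321$-pattern of $w$; (3) the first left-to-right minimum of $w$ after $w(1)$ is $1$. Moreover, a forced top-perimeter tile for $w$, when it exists, necessarily has labels $\{1,w(1)\}$. -/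

import Mathlib

namespace Elnitsky

/-! Permutations of `{1, …, n}` are elements of `Equiv.Perm (Fin n)`: the label (or position) `k`
of the one-based convention is the element of `Fin n` with value `k - 1`, so `1` becomes `0` and
`w(1)` becomes `w 0`. The plane is `ℂ`. -/

/-- Full support: `{w(1), …, w(r)} ≠ {1, …, r}` for every `1 ≤ r < n`. -/
def FullySupported {n : ℕ} (w : Equiv.Perm (Fin n)) : Prop :=
  ∀ r : ℕ, 1 ≤ r → r < n → w '' {i : Fin n | (i : ℕ) < r} ≠ {i : Fin n | (i : ℕ) < r}

/-- The entries in positions `i`, `j`, `k` form a `321`-pattern of `w`. -/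
def Is321 {n : ℕ} (w : Equiv.Perm (Fin n)) (i j k : Fin n) : Prop :=
  i < j ∧ j < k ∧ w k < w j ∧ w j < w i

/-- The values `a` and `b` occur together in some `321`-pattern of `w`. -/
def Together321 {n : ℕ} (w : Equiv.Perm (Fin n)) (a b : Fin n) : Prop :=
  ∃ i j k : Fin n, Is321 w i j k ∧
    a ∈ ({w i, w j, w k} : Finset (Fin n)) ∧ b ∈ ({w i, w j, w k} : Finset (Fin n))

/-- The entry in position `i` is a left-to-right minimum of `w`. -/
def IsLRMin {n : ℕ} (w : Equiv.Perm (Fin n)) (i : Fin n) : Prop :=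
  ∀ j : Fin n, j < i → w i < w j

/-- Among the left-to-right minima strictly after the first position, the first one has
value `a`. -/
def FirstLRMinAfterFirstIs {n : ℕ} [NeZero n] (w : Equiv.Perm (Fin n)) (a : Fin n) : Prop :=
  ∃ i : Fin n, IsLeast {j : Fin n | 0 < j ∧ IsLRMin w j} i ∧ w i = a

/-- Admissible directions of the sides `1, …, n` read downwards from the top vertex along the
leftside boundary. They point strictly downwards and turn counterclockwise, so that the sides form
half of a (centrally symmetric) convex `2n`-gon. -/
def IsDirections {n : ℕ} (θ : Fin n → ℝ) : Prop :=
  StrictMono θ ∧ ∀ i, θ i ∈ Set.Ioo Real.pi (2 * Real.pi)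

noncomputable section

/-- The unit vector along the sides with label `i`, directed downwards. -/
def sideVec {n : ℕ} (θ : Fin n → ℝ) (i : Fin n) : ℂ :=
  Complex.exp ((θ i : ℂ) * Complex.I)

/-- The vertex reached from the top vertex (placed at the origin) after following the first `k` of
the sides labeled `σ(1), …, σ(n)` downwards. -/
def pathVertex {n : ℕ} (θ : Fin n → ℝ) (σ : Equiv.Perm (Fin n)) (k : ℕ) : ℂ :=
  ∑ i ∈ Finset.univ.filter (fun i : Fin n => (i : ℕ) < k), sideVec θ (σ i)

/-- The side in position `k` (from the top) of the path with labels `σ(1), …, σ(n)`. -/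
def pathSide {n : ℕ} (θ : Fin n → ℝ) (σ : Equiv.Perm (Fin n)) (k : Fin n) : Set ℂ :=
  segment ℝ (pathVertex θ σ k) (pathVertex θ σ ((k : ℕ) + 1))

/-- The path from the top vertex to the bottom vertex with sides labeled `σ(1), …, σ(n)`. -/
def path {n : ℕ} (θ : Fin n → ℝ) (σ : Equiv.Perm (Fin n)) : Set ℂ :=
  ⋃ k : Fin n, pathSide θ σ k

/-- The leftside boundary, with labels `1, …, n` from top to bottom. -/
def leftBoundary {n : ℕ} (θ : Fin n → ℝ) : Set ℂ := path θ 1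

/-- The rightside boundary, with labels `w(1), …, w(n)` from top to bottom. -/
def rightBoundary {n : ℕ} (θ : Fin n → ℝ) (w : Equiv.Perm (Fin n)) : Set ℂ := path θ w

/-- Elnitsky's polygon `X(w)`, as a closed region of the plane. The leftside and the rightside
boundary both descend strictly from the top vertex to the bottom vertex, so the region that
they bound consists of the horizontal segments from the former to the latter. -/
def polygon {n : ℕ} (θ : Fin n → ℝ) (w : Equiv.Perm (Fin n)) : Set ℂ :=
  {p | ∃ a ∈ leftBoundary θ, ∃ b ∈ rightBoundary θ w,
    a.im = p.im ∧ b.im = p.im ∧ a.re ≤ p.re ∧ p.re ≤ b.re}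

/-- A rhombus whose edges are congruent and parallel to the sides with labels `lo` and `hi`; it is
given by its topmost vertex and its two labels. -/
structure Tile (n : ℕ) where
  top : ℂ
  lo : Fin n
  hi : Fin n
  lo_lt_hi : lo < hi

/-- The (two-element) set of labels of a tile. -/
def Tile.labels {n : ℕ} (t : Tile n) : Finset (Fin n) := {t.lo, t.hi}

/-- The closed rhombus occupied by a tile. -/
def Tile.region {n : ℕ} (θ : Fin n → ℝ) (t : Tile n) : Set ℂ :=
  {p | ∃ a ∈ Set.Icc (0 : ℝ) 1, ∃ b ∈ Set.Icc (0 : ℝ) 1,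
    p = t.top + a • sideVec θ t.lo + b • sideVec θ t.hi}

/-- The four edges of a tile. -/
def Tile.edges {n : ℕ} (θ : Fin n → ℝ) (t : Tile n) : Set (Set ℂ) :=
  {segment ℝ t.top (t.top + sideVec θ t.lo),
   segment ℝ t.top (t.top + sideVec θ t.hi),
   segment ℝ (t.top + sideVec θ t.lo) (t.top + sideVec θ t.lo + sideVec θ t.hi),
   segment ℝ (t.top + sideVec θ t.hi) (t.top + sideVec θ t.lo + sideVec θ t.hi)}

/-- `T` is a rhombic tiling of `X(w)`, that is, an element of `T(w)`: the tiles cover exactly the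
polygon, and distinct tiles have disjoint interiors. -/
def IsRhombicTiling {n : ℕ} (θ : Fin n → ℝ) (w : Equiv.Perm (Fin n)) (T : Finset (Tile n)) :
    Prop :=
  (⋃ t ∈ T, t.region θ) = polygon θ w ∧
  ∀ s ∈ T, ∀ t ∈ T, s ≠ t → Disjoint (interior (s.region θ)) (interior (t.region θ))

/-- A top-perimeter tile shares with the boundary of `X(w)` the two sides on either side of the
top vertex: the first side of the leftside boundary and the first side of the rightside
boundary. -/
def IsTopPerimeter {n : ℕ} [NeZero n] (θ : Fin n → ℝ) (w : Equiv.Perm (Fin n)) (t : Tile n) :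
    Prop :=
  pathSide θ 1 0 ∈ t.edges θ ∧ pathSide θ w 0 ∈ t.edges θ

/-- A forced top-perimeter tile appears as a top-perimeter tile in all rhombic tilings of
`X(w)`. -/
def IsForcedTopPerimeter {n : ℕ} [NeZero n] (θ : Fin n → ℝ) (w : Equiv.Perm (Fin n))
    (t : Tile n) : Prop :=
  ∀ T : Finset (Tile n), IsRhombicTiling θ w T → t ∈ T ∧ IsTopPerimeter θ w t

end

end Elnitsky

namespace Elnitsky

noncomputable section

variable {n : ℕ} {θ : Fin n → ℝ}

/-! Parametrized by depth below the top vertex, every descending path is the graph of a function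
`profile`, and `X(σ)` is the region between the graphs of `1` and `σ`. Exchanging two adjacent sides
that form a descent of `σ` cuts exactly one rhombus off the right of this region
(`IsCornerTile.polygon_eq`). Conversely, a nonempty tiling has a tile with nothing on its right
(`Tile.exists_not_leftOf`), and that tile sits in a corner of the right boundary
(`exists_isCornerTile`), so a tiling can be peeled tile by tile. Exchanging a descent creates no
inversion, hence the labels of every tile form an inversion (`symm_hi_lt_symm_lo`). The permutations
met on the way need not be fully supported, and parts of the left boundary may then lie in no tile;
the induction therefore runs over quasi-tilings, and full support is used only to recover genuine
tilings (`isRhombicTiling`) and `w 0 ≠ 0`.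

The first left side always lies along a tile at the top vertex, with labels `0` and some `hi ≤ w 0`
(`exists_top_tile`). If `hi ≠ w 0`, the inversion `hi, 0` extends to the 321-pattern `w 0, hi, 0`;
without such patterns the tile is forced. Given a pattern `w 0, b, 0`, sort `w` by undoing first
only descents whose larger value exceeds `b`. Then `b` stays ahead of `0`, so none of these steps
cuts off a top tile with labels `0` and `w 0`, and the tiles left over have no label above `b`
(`exists_avoiding`). As for left-to-right minima, `0` is always one, and another one strictly
between the first position and `0` exists exactly when there is such a pattern. -/

/-- The height of a side with label `i`. -/
def drop (θ : Fin n → ℝ) (i : Fin n) : ℝ := -Real.sin (θ i)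

/-- The horizontal displacement per unit of depth along a side with label `i`. -/
def slope (θ : Fin n → ℝ) (i : Fin n) : ℝ := -(Real.cos (θ i) / Real.sin (θ i))

lemma sideVec_im (θ : Fin n → ℝ) (i : Fin n) : (sideVec θ i).im = -drop θ i := by
  simp [sideVec, drop, Complex.exp_ofReal_mul_I_im]

lemma drop_pos (hθ : IsDirections θ) (i : Fin n) : 0 < drop θ i := by
  obtain ⟨h1, h2⟩ := hθ.2 i
  have := Real.sin_pos_of_pos_of_lt_pi (x := θ i - Real.pi) (by linarith) (by linarith)
  rw [Real.sin_sub_pi] at this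
  exact this

lemma sideVec_re (hθ : IsDirections θ) (i : Fin n) :
    (sideVec θ i).re = slope θ i * drop θ i := by
  have h := drop_pos hθ i
  have h' : Real.sin (θ i) ≠ 0 := by unfold drop at h; linarith
  simp only [sideVec, Complex.exp_ofReal_mul_I_re, drop, slope]
  field_simp

/-- The difference of two slopes is `sin (θ j - θ i) / (sin (θ i) * sin (θ j))`, and all angles lie
in one open half-turn where the sine is negative. -/
lemma slope_strictMono (hθ : IsDirections θ) : StrictMono (slope θ) := by
  intro i j hij
  have hi := drop_pos hθ i
  have hj := drop_pos hθ j
  have h := Real.sin_pos_of_pos_of_lt_pi (x := θ j - θ i) (by linarith [hθ.1 hij])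
    (by linarith [(hθ.2 i).1, (hθ.2 j).2])
  rw [Real.sin_sub] at h
  unfold drop at hi hj
  have hi' : Real.sin (θ i) ≠ 0 := by linarith
  have hj' : Real.sin (θ j) ≠ 0 := by linarith
  have key : slope θ j - slope θ i =
      (Real.sin (θ j) * Real.cos (θ i) - Real.cos (θ j) * Real.sin (θ i)) /
        (Real.sin (θ i) * Real.sin (θ j)) := by
    unfold slope
    field_simp
    ring
  have : 0 < slope θ j - slope θ i := by
    rw [key]
    exact div_pos h (mul_pos_of_neg_of_neg (by linarith) (by linarith))
  linarith

/-! ### Paths as graphs over the depth -/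

/-- The depth of the `k`-th vertex of a path below the top vertex. -/
def depth (θ : Fin n → ℝ) (σ : Equiv.Perm (Fin n)) (k : ℕ) : ℝ := -(pathVertex θ σ k).im

/-- The total height of the polygon. -/
def height (θ : Fin n → ℝ) : ℝ := ∑ i, drop θ i

lemma pathVertex_succ (θ : Fin n → ℝ) (σ : Equiv.Perm (Fin n)) (k : Fin n) :
    pathVertex θ σ ((k : ℕ) + 1) = pathVertex θ σ k + sideVec θ (σ k) := by
  have : Finset.univ.filter (fun i : Fin n => (i : ℕ) < (k : ℕ) + 1) =
      insert k (Finset.univ.filter (fun i : Fin n => (i : ℕ) < k)) := by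
    ext i
    simp only [Finset.mem_filter, Finset.mem_univ, true_and, Finset.mem_insert, Fin.ext_iff]
    omega
  unfold pathVertex
  rw [this, Finset.sum_insert (by simp), add_comm]

lemma pathVertex_zero (θ : Fin n → ℝ) (σ : Equiv.Perm (Fin n)) : pathVertex θ σ 0 = 0 := by
  simp [pathVertex]

lemma pathVertex_last (θ : Fin n → ℝ) (σ : Equiv.Perm (Fin n)) :
    pathVertex θ σ n = ∑ i, sideVec θ i := by
  simp [pathVertex, Equiv.sum_comp σ (sideVec θ)]

lemma depth_eq_sum (θ : Fin n → ℝ) (σ : Equiv.Perm (Fin n)) (k : ℕ) :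
    depth θ σ k = ∑ i ∈ Finset.univ.filter (fun i : Fin n => (i : ℕ) < k), drop θ (σ i) := by
  simp [depth, pathVertex, sideVec_im]

lemma depth_zero (θ : Fin n → ℝ) (σ : Equiv.Perm (Fin n)) : depth θ σ 0 = 0 := by
  simp [depth, pathVertex_zero]

lemma depth_last (θ : Fin n → ℝ) (σ : Equiv.Perm (Fin n)) : depth θ σ n = height θ := by
  simp [depth, pathVertex_last, height, sideVec_im]

lemma depth_succ (θ : Fin n → ℝ) (σ : Equiv.Perm (Fin n)) (k : Fin n) :
    depth θ σ ((k : ℕ) + 1) = depth θ σ k + drop θ (σ k) := by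
  simp only [depth, pathVertex_succ, Complex.add_im, sideVec_im]
  ring

lemma depth_mono (hθ : IsDirections θ) (σ : Equiv.Perm (Fin n)) : Monotone (depth θ σ) := by
  intro a b hab
  rw [depth_eq_sum, depth_eq_sum]
  refine Finset.sum_le_sum_of_subset_of_nonneg ?_ fun i _ _ => (drop_pos hθ _).le
  intro i
  simp only [Finset.mem_filter, Finset.mem_univ, true_and]
  omega

lemma depth_lt (hθ : IsDirections θ) (σ : Equiv.Perm (Fin n)) {k : Fin n} {l : ℕ}
    (h : (k : ℕ) < l) : depth θ σ k < depth θ σ l := by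
  have h1 := depth_mono hθ σ (Nat.succ_le_of_lt h)
  have h2 := depth_succ θ σ k
  have h3 := drop_pos hθ (σ k)
  simp only [Nat.succ_eq_add_one] at h1
  linarith

lemma exists_depth_le_lt (σ : Equiv.Perm (Fin n)) {d : ℝ} (h0 : 0 ≤ d)
    (h1 : d < height θ) : ∃ i : Fin n, depth θ σ i ≤ d ∧ d < depth θ σ ((i : ℕ) + 1) := by
  classical
  have hex : ∃ k, d < depth θ σ k := ⟨n, by rwa [depth_last]⟩
  have hpos : Nat.find hex ≠ 0 := by
    intro h
    have := Nat.find_spec hex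
    rw [h, depth_zero] at this
    linarith
  obtain ⟨k, hk⟩ := Nat.exists_eq_succ_of_ne_zero hpos
  have hle : Nat.find hex ≤ n := Nat.find_min' hex (by rwa [depth_last])
  refine ⟨⟨k, by omega⟩, ?_, ?_⟩
  · exact not_lt.1 (Nat.find_min hex (m := k) (by omega))
  · have := Nat.find_spec hex
    rwa [hk] at this

lemma exists_depth_le_le (hθ : IsDirections θ) (hn : 0 < n) (σ : Equiv.Perm (Fin n)) {d : ℝ}
    (h0 : 0 ≤ d) (h1 : d ≤ height θ) :
    ∃ i : Fin n, depth θ σ i ≤ d ∧ d ≤ depth θ σ ((i : ℕ) + 1) := by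
  rcases h1.lt_or_eq with h | h
  · obtain ⟨i, hi, hi'⟩ := exists_depth_le_lt σ h0 h
    exact ⟨i, hi, hi'.le⟩
  · have hn1 : n - 1 + 1 = n := by omega
    refine ⟨⟨n - 1, by omega⟩, ?_, ?_⟩
    · rw [h, ← depth_last θ σ]
      exact depth_mono hθ σ (Nat.sub_le n 1)
    · simp only [hn1, depth_last, h, le_refl]

/-- The length of the part of the `i`-th side of a path lying above depth `d`, measured
vertically. -/
def usedDrop (θ : Fin n → ℝ) (σ : Equiv.Perm (Fin n)) (d : ℝ) (i : Fin n) : ℝ :=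
  min d (depth θ σ ((i : ℕ) + 1)) - min d (depth θ σ i)

/-- The abscissa of the point of a path at depth `d`. -/
def profile (θ : Fin n → ℝ) (σ : Equiv.Perm (Fin n)) (d : ℝ) : ℝ :=
  ∑ i : Fin n, slope θ (σ i) * usedDrop θ σ d i

lemma continuous_profile (θ : Fin n → ℝ) (σ : Equiv.Perm (Fin n)) :
    Continuous (profile θ σ) := by
  unfold profile usedDrop
  fun_prop

/-- Sides above the `i`-th are used up and add up to the vertex; sides below it contribute nothing.
-/
lemma profile_eq (hθ : IsDirections θ) (σ : Equiv.Perm (Fin n)) {d : ℝ} {i : Fin n}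
    (h1 : depth θ σ i ≤ d) (h2 : d ≤ depth θ σ ((i : ℕ) + 1)) :
    profile θ σ d = (pathVertex θ σ i).re + slope θ (σ i) * (d - depth θ σ i) := by
  have hterm : ∀ j : Fin n, slope θ (σ j) * usedDrop θ σ d j =
      (if (j : ℕ) < i then (sideVec θ (σ j)).re else 0) +
        (if j = i then slope θ (σ j) * (d - depth θ σ j) else 0) := by
    intro j
    unfold usedDrop
    rcases lt_trichotomy j i with h | h | h
    · have ha := depth_mono hθ σ (show (j : ℕ) + 1 ≤ i from h)
      have hb := depth_mono hθ σ (show (j : ℕ) ≤ i from h.le)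
      rw [if_pos (show (j : ℕ) < i from h), if_neg h.ne, min_eq_right (by linarith),
        min_eq_right (by linarith), depth_succ, sideVec_re hθ]
      ring
    · subst h
      rw [if_neg (by omega), if_pos rfl, min_eq_left h2, min_eq_right h1]
      ring
    · have ha := depth_mono hθ σ (show (i : ℕ) + 1 ≤ j from h)
      have hb := depth_mono hθ σ (show (i : ℕ) + 1 ≤ (j : ℕ) + 1 by
        have : (i : ℕ) < j := h
        omega)
      rw [if_neg (by have : (i : ℕ) < j := h; omega), if_neg h.ne', min_eq_left (by linarith),
        min_eq_left (by linarith)]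
      ring
  unfold profile
  rw [Finset.sum_congr rfl fun j _ => hterm j, Finset.sum_add_distrib, Finset.sum_ite_eq',
    if_pos (Finset.mem_univ _), ← Finset.sum_filter]
  simp [pathVertex]

lemma mem_pathSide (hθ : IsDirections θ) (σ : Equiv.Perm (Fin n)) (k : Fin n) (p : ℂ) :
    p ∈ pathSide θ σ k ↔ depth θ σ k ≤ -p.im ∧ -p.im ≤ depth θ σ ((k : ℕ) + 1) ∧
      p.re = profile θ σ (-p.im) := by
  have hd := drop_pos hθ (σ k)
  unfold pathSide
  rw [pathVertex_succ, segment_eq_image']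
  constructor
  · rintro ⟨t, ⟨ht0, ht1⟩, rfl⟩
    have him : -(pathVertex θ σ k + t • (pathVertex θ σ k + sideVec θ (σ k) -
        pathVertex θ σ k)).im = depth θ σ k + t * drop θ (σ k) := by
      simp [depth, sideVec_im]
      ring
    have h1 : depth θ σ k ≤ depth θ σ k + t * drop θ (σ k) := by nlinarith
    have h2 : depth θ σ k + t * drop θ (σ k) ≤ depth θ σ ((k : ℕ) + 1) := by
      rw [depth_succ]
      nlinarith
    simp only [him]
    refine ⟨h1, h2, ?_⟩
    rw [profile_eq hθ σ h1 h2]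
    simp [sideVec_re hθ]
    ring
  · rintro ⟨h1, h2, h3⟩
    rw [profile_eq hθ σ h1 h2] at h3
    rw [depth_succ] at h2
    refine ⟨(-p.im - depth θ σ k) / drop θ (σ k), ⟨?_, ?_⟩, ?_⟩
    · exact div_nonneg (by linarith) hd.le
    · rw [div_le_one hd]
      linarith
    · apply Complex.ext
      · simp [sideVec_re hθ, h3]
        field_simp
      · simp [sideVec_im]
        field_simp
        simp [depth]

lemma mem_path (hθ : IsDirections θ) (hn : 0 < n) (σ : Equiv.Perm (Fin n)) (p : ℂ) :
    p ∈ path θ σ ↔ 0 ≤ -p.im ∧ -p.im ≤ height θ ∧ p.re = profile θ σ (-p.im) := by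
  simp only [path, Set.mem_iUnion, mem_pathSide hθ]
  constructor
  · rintro ⟨k, h1, h2, h3⟩
    refine ⟨?_, ?_, h3⟩
    · have := depth_mono hθ σ (Nat.zero_le k)
      rw [depth_zero] at this
      linarith
    · have := depth_mono hθ σ (show (k : ℕ) + 1 ≤ n from k.2)
      rw [depth_last] at this
      linarith
  · rintro ⟨h1, h2, h3⟩
    obtain ⟨i, hi, hi'⟩ := exists_depth_le_le hθ hn σ h1 h2
    exact ⟨i, hi, hi', h3⟩

lemma mem_polygon (hθ : IsDirections θ) (hn : 0 < n) (σ : Equiv.Perm (Fin n)) (p : ℂ) :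
    p ∈ polygon θ σ ↔ 0 ≤ -p.im ∧ -p.im ≤ height θ ∧
      profile θ 1 (-p.im) ≤ p.re ∧ p.re ≤ profile θ σ (-p.im) := by
  simp only [polygon, leftBoundary, rightBoundary, mem_path hθ hn, Set.mem_ofPred_eq]
  constructor
  · rintro ⟨a, ⟨ha1, ha2, ha3⟩, b, ⟨hb1, hb2, hb3⟩, h1, h2, h3, h4⟩
    rw [h1] at ha1 ha2 ha3
    rw [h2] at hb3
    exact ⟨ha1, ha2, ha3 ▸ h3, hb3 ▸ h4⟩
  · rintro ⟨h1, h2, h3, h4⟩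
    exact ⟨⟨profile θ 1 (-p.im), p.im⟩, ⟨h1, h2, rfl⟩, ⟨profile θ σ (-p.im), p.im⟩,
      ⟨h1, h2, rfl⟩, rfl, rfl, h3, h4⟩

lemma isClosed_polygon (hθ : IsDirections θ) (hn : 0 < n) (σ : Equiv.Perm (Fin n)) :
    IsClosed (polygon θ σ) := by
  have : polygon θ σ = {p | 0 ≤ -p.im ∧ -p.im ≤ height θ ∧
      profile θ 1 (-p.im) ≤ p.re ∧ p.re ≤ profile θ σ (-p.im)} :=
    Set.ext fun p => mem_polygon hθ hn σ p
  rw [this]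
  have h1 := continuous_profile θ 1
  have h2 := continuous_profile θ σ
  have him : Continuous fun p : ℂ => -p.im := Complex.continuous_im.neg
  simp only [Set.ofPred_and]
  exact (isClosed_le continuous_const him).inter ((isClosed_le him continuous_const).inter
    ((isClosed_le (h1.comp him) Complex.continuous_re).inter
      (isClosed_le Complex.continuous_re (h2.comp him))))

/-! ### Comparison with the left boundary -/

lemma sum_usedDrop (σ : Equiv.Perm (Fin n)) {d : ℝ} (h0 : 0 ≤ d) (h1 : d ≤ height θ) :
    ∑ i, usedDrop θ σ d i = d := by
  unfold usedDrop
  rw [Fin.sum_univ_eq_sum_range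
    (fun i => min d (depth θ σ (i + 1)) - min d (depth θ σ i)) n,
    Finset.sum_range_sub (fun i => min d (depth θ σ i)), depth_last, depth_zero,
    min_eq_left h1, min_eq_right h0, sub_zero]

lemma usedDrop_nonneg (hθ : IsDirections θ) (σ : Equiv.Perm (Fin n)) (d : ℝ) (i : Fin n) :
    0 ≤ usedDrop θ σ d i :=
  sub_nonneg.2 (min_le_min_left d (depth_mono hθ σ (Nat.le_succ _)))

lemma usedDrop_le (hθ : IsDirections θ) (σ : Equiv.Perm (Fin n)) (d : ℝ) (i : Fin n) :
    usedDrop θ σ d i ≤ drop θ (σ i) := by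
  have := drop_pos hθ (σ i)
  unfold usedDrop
  rw [depth_succ]
  rcases le_total d (depth θ σ i) with h | h
  · rw [min_eq_left h, min_eq_left (by linarith)]
    linarith
  · rw [min_eq_right h]
    have := min_le_right d (depth θ σ i + drop θ (σ i))
    linarith

lemma usedDrop_of_le (hθ : IsDirections θ) (σ : Equiv.Perm (Fin n)) {d : ℝ} {i : Fin n}
    (h : d ≤ depth θ σ i) : usedDrop θ σ d i = 0 := by
  unfold usedDrop
  rw [min_eq_left h, min_eq_left (h.trans (depth_mono hθ σ (Nat.le_succ _))), sub_self]

lemma usedDrop_of_ge (hθ : IsDirections θ) (σ : Equiv.Perm (Fin n)) {d : ℝ} {i : Fin n}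
    (h : depth θ σ ((i : ℕ) + 1) ≤ d) : usedDrop θ σ d i = drop θ (σ i) := by
  unfold usedDrop
  rw [min_eq_right h, min_eq_right ((depth_mono hθ σ (Nat.le_succ _)).trans h), depth_succ]
  ring

/-- Both families of used drops sum to `d`, so a constant may be subtracted from all slopes. With
`k` the left side met at depth `d`, every summand becomes nonnegative. -/
lemma profile_sub_profile_one (σ : Equiv.Perm (Fin n)) {d : ℝ} (h0 : 0 ≤ d)
    (h1 : d ≤ height θ) (k : Fin n) :
    profile θ σ d - profile θ 1 d = ∑ j, (slope θ j - slope θ k) *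
      (usedDrop θ σ d (σ.symm j) - usedDrop θ 1 d j) := by
  have e1 : profile θ σ d = ∑ j, slope θ j * usedDrop θ σ d (σ.symm j) := by
    unfold profile
    rw [← Equiv.sum_comp σ (fun j => slope θ j * usedDrop θ σ d (σ.symm j))]
    simp only [Equiv.symm_apply_apply]
  have e2 : ∑ j, usedDrop θ σ d (σ.symm j) = d := by
    rw [Equiv.sum_comp σ.symm, sum_usedDrop σ h0 h1]
  have e3 : ∑ j, slope θ k * usedDrop θ σ d (σ.symm j) = ∑ j, slope θ k * usedDrop θ 1 d j := by
    rw [← Finset.mul_sum, ← Finset.mul_sum, e2, sum_usedDrop 1 h0 h1]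
  have e4 : profile θ 1 d = ∑ j, slope θ j * usedDrop θ 1 d j := by simp [profile]
  rw [e1, e4]
  simp only [sub_mul, mul_sub, Finset.sum_sub_distrib, e3]
  ring

/-- At depth `d` the left boundary has used labels below `k` completely and labels above `k` not at
all, so both factors have the same sign. -/
lemma slope_sub_mul_nonneg (hθ : IsDirections θ) (σ : Equiv.Perm (Fin n)) {d : ℝ} {k : Fin n}
    (hk1 : depth θ 1 k ≤ d) (hk2 : d ≤ depth θ 1 ((k : ℕ) + 1)) (j : Fin n) :
    0 ≤ (slope θ j - slope θ k) * (usedDrop θ σ d (σ.symm j) - usedDrop θ 1 d j) := by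
  rcases lt_trichotomy j k with h | h | h
  · have h3 := slope_strictMono hθ h
    have h4 := usedDrop_le hθ σ d (σ.symm j)
    rw [usedDrop_of_ge hθ 1 ((depth_mono hθ 1 (show (j : ℕ) + 1 ≤ k from h)).trans hk1)]
    rw [Equiv.apply_symm_apply] at h4
    exact mul_nonneg_of_nonpos_of_nonpos (by linarith) (by simpa using h4)
  · simp [h]
  · have h3 := slope_strictMono hθ h
    have h4 := usedDrop_nonneg hθ σ d (σ.symm j)
    rw [usedDrop_of_le hθ 1 (hk2.trans (depth_mono hθ 1 (show (k : ℕ) + 1 ≤ j from h)))]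
    exact mul_nonneg (by linarith) (by linarith)

lemma profile_one_le (hθ : IsDirections θ) (hn : 0 < n) (σ : Equiv.Perm (Fin n)) {d : ℝ}
    (h0 : 0 ≤ d) (h1 : d ≤ height θ) : profile θ 1 d ≤ profile θ σ d := by
  obtain ⟨k, hk1, hk2⟩ := exists_depth_le_le hθ hn 1 h0 h1
  have h := profile_sub_profile_one σ h0 h1 k
  have := Finset.sum_nonneg fun j (_ : j ∈ Finset.univ) => slope_sub_mul_nonneg hθ σ hk1 hk2 j
  linarith

/-- If the paths met inside the side `k`, every summand would vanish and `σ` would have used each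
label as much as the identity. The labels below `k` would then fill exactly the positions before
that of `k`, against full support. -/
lemma profile_one_lt (hθ : IsDirections θ) (hn : 2 ≤ n) {σ : Equiv.Perm (Fin n)}
    (hσ : FullySupported σ) {d : ℝ} {k : Fin n}
    (hk1 : depth θ 1 k < d) (hk2 : d < depth θ 1 ((k : ℕ) + 1)) :
    profile θ 1 d < profile θ σ d := by
  have h0 : 0 ≤ d := by
    have := depth_mono hθ 1 (Nat.zero_le k)
    rw [depth_zero] at this
    linarith
  have h1 : d ≤ height θ := by
    have := depth_mono hθ 1 (show (k : ℕ) + 1 ≤ n from k.2)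
    rw [depth_last] at this
    linarith
  refine lt_of_le_of_ne (profile_one_le hθ (by omega) σ h0 h1) fun heq => ?_
  have hsum := profile_sub_profile_one σ h0 h1 k
  rw [heq, sub_self, eq_comm, Finset.sum_eq_zero_iff_of_nonneg
    fun j _ => slope_sub_mul_nonneg hθ σ hk1.le hk2.le j] at hsum
  have hne : ∀ j, j ≠ k → usedDrop θ σ d (σ.symm j) = usedDrop θ 1 d j := by
    intro j hj
    have h2 := hsum j (Finset.mem_univ _)
    have h3 : slope θ j - slope θ k ≠ 0 :=
      sub_ne_zero.2 fun h => hj ((slope_strictMono hθ).injective h)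
    exact sub_eq_zero.1 ((mul_eq_zero.1 h2).resolve_left h3)
  have hk : usedDrop θ σ d (σ.symm k) = usedDrop θ 1 d k := by
    have e1 : ∑ j, usedDrop θ σ d (σ.symm j) = d := by
      rw [Equiv.sum_comp σ.symm, sum_usedDrop σ h0 h1]
    have e2 := sum_usedDrop (θ := θ) 1 h0 h1
    rw [← Finset.add_sum_erase _ _ (Finset.mem_univ k)] at e1 e2
    rw [Finset.sum_congr rfl fun j hj => hne j (Finset.ne_of_mem_erase hj)] at e1
    linarith
  have hk' : usedDrop θ 1 d k = d - depth θ 1 k := by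
    unfold usedDrop
    rw [min_eq_left hk2.le, min_eq_right hk1.le]
  have hks := depth_succ θ 1 k
  have hi1 : depth θ σ (σ.symm k) < d := by
    by_contra! h
    rw [usedDrop_of_le hθ σ h] at hk
    linarith
  have hi2 : d < depth θ σ ((σ.symm k : ℕ) + 1) := by
    by_contra! h
    rw [usedDrop_of_ge hθ σ h, Equiv.apply_symm_apply] at hk
    simp only [Equiv.Perm.coe_one, id_eq] at hks
    linarith
  have hiff : ∀ i, σ i < k ↔ i < σ.symm k := by
    intro i
    constructor
    · intro h
      by_contra! h'
      rcases h'.eq_or_lt with h' | h'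
      · rw [← h', Equiv.apply_symm_apply] at h
        exact lt_irrefl _ h
      · have h2 := hne (σ i) h.ne
        rw [Equiv.symm_apply_apply, usedDrop_of_le hθ σ
          (hi2.le.trans (depth_mono hθ σ (show (σ.symm k : ℕ) + 1 ≤ i from h'))),
          usedDrop_of_ge hθ 1 ((depth_mono hθ 1 (show (σ i : ℕ) + 1 ≤ k from h)).trans hk1.le)] at h2
        exact (drop_pos hθ _).ne h2
    · intro h
      by_contra! h'
      rcases h'.eq_or_lt with h' | h'
      · rw [h', Equiv.symm_apply_apply] at h
        exact lt_irrefl _ h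
      · have h2 := hne (σ i) h'.ne'
        rw [Equiv.symm_apply_apply, usedDrop_of_ge hθ σ
          ((depth_mono hθ σ (show (i : ℕ) + 1 ≤ σ.symm k from h)).trans hi1.le),
          usedDrop_of_le hθ 1 (hk2.le.trans (depth_mono hθ 1 (show (k : ℕ) + 1 ≤ σ i from h')))] at h2
        exact (drop_pos hθ _).ne' h2
  have hcard : σ.symm k = k := by
    have : (Finset.Iio (σ.symm k)).map σ.toEmbedding = Finset.Iio k := by
      ext j
      simp only [Finset.mem_map_equiv, Finset.mem_Iio, ← hiff, Equiv.apply_symm_apply]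
    have h2 := congrArg Finset.card this
    rw [Finset.card_map, Fin.card_Iio, Fin.card_Iio] at h2
    exact Fin.ext h2
  rw [hcard] at hiff
  have himage : ∀ r : ℕ, (∀ i, (σ i : ℕ) < r ↔ (i : ℕ) < r) →
      σ '' {i : Fin n | (i : ℕ) < r} = {i : Fin n | (i : ℕ) < r} := by
    intro r hr
    rw [Equiv.image_eq_preimage_symm]
    ext j
    have := hr (σ.symm j)
    rw [Equiv.apply_symm_apply] at this
    exact this.symm
  -- Full support says nothing about `r = 0`; when `k = 0`, the fixed point `σ 0 = 0` contradicts it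
  -- at `r = 1`.
  rcases Nat.eq_zero_or_pos k with h | h
  · refine hσ 1 le_rfl (by omega) (himage 1 fun i => ?_)
    have hk0 : σ k = k := by rw [← hcard, Equiv.apply_symm_apply, hcard]
    have e : ∀ j : Fin n, (j : ℕ) < 1 ↔ j = k := fun j => by rw [Fin.ext_iff]; omega
    rw [e, e]
    constructor
    · intro h'
      exact σ.injective (h'.trans hk0.symm)
    · rintro rfl
      exact hk0
  · exact hσ k h k.2 (himage k fun i => hiff i)

/-! ### Effect of an adjacent exchange on vertices and profiles -/

lemma pathVertex_mul_swap (σ : Equiv.Perm (Fin n)) {k l : Fin n} (hkl : (l : ℕ) = k + 1)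
    {m : ℕ} (hm : m ≠ l) :
    pathVertex θ (σ * Equiv.swap k l) m = pathVertex θ σ m := by
  unfold pathVertex
  rw [Finset.sum_filter, Finset.sum_filter, ← Equiv.sum_comp (Equiv.swap k l)]
  refine Finset.sum_congr rfl fun i _ => ?_
  rw [Equiv.Perm.mul_apply, Equiv.swap_apply_self]
  have : ((Equiv.swap k l i : Fin n) : ℕ) < m ↔ (i : ℕ) < m := by
    rw [Equiv.swap_apply_def]
    split_ifs with h1 h2
    · subst h1; omega
    · subst h2; omega
    · rfl
  simp only [this]

lemma depth_mul_swap (σ : Equiv.Perm (Fin n)) {k l : Fin n} (hkl : (l : ℕ) = k + 1)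
    {m : ℕ} (hm : m ≠ l) : depth θ (σ * Equiv.swap k l) m = depth θ σ m := by
  rw [depth, depth, pathVertex_mul_swap σ hkl hm]

lemma profile_mul_swap_of_notMem (hθ : IsDirections θ) (σ : Equiv.Perm (Fin n)) {k l : Fin n}
    (hkl : (l : ℕ) = k + 1) {d : ℝ} (h0 : 0 ≤ d) (h1 : d ≤ height θ)
    (hd : ¬(depth θ σ k ≤ d ∧ d ≤ depth θ σ ((l : ℕ) + 1))) :
    profile θ (σ * Equiv.swap k l) d = profile θ σ d := by
  obtain ⟨i, hi1, hi2⟩ := exists_depth_le_le hθ k.pos σ h0 h1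
  have hik : i ≠ k := by
    rintro rfl
    exact hd ⟨hi1, hi2.trans (depth_mono hθ σ (by omega))⟩
  have hil : i ≠ l := by
    rintro rfl
    exact hd ⟨(depth_mono hθ σ (by omega)).trans hi1, hi2⟩
  have e1 : (i : ℕ) ≠ l := fun h => hil (Fin.ext h)
  have e2 : (i : ℕ) + 1 ≠ l := fun h => hik (Fin.ext (by omega))
  rw [profile_eq hθ σ hi1 hi2, profile_eq hθ (σ * Equiv.swap k l)
    (by rwa [depth_mul_swap σ hkl e1]) (by rwa [depth_mul_swap σ hkl e2]),
    pathVertex_mul_swap σ hkl e1, depth_mul_swap σ hkl e1, Equiv.Perm.mul_apply,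
    Equiv.swap_apply_of_ne_of_ne hik hil]

/-- The `min` merges the two sides into one formula, so that the paths before and after the exchange
can be compared without splitting at their different middle vertices. -/
lemma profile_two_sides (hθ : IsDirections θ) (σ : Equiv.Perm (Fin n)) {k l : Fin n}
    (hkl : (l : ℕ) = k + 1) {d : ℝ} (h1 : depth θ σ k ≤ d)
    (h2 : d ≤ depth θ σ ((l : ℕ) + 1)) :
    profile θ σ d = (pathVertex θ σ k).re +
      slope θ (σ k) * min (d - depth θ σ k) (drop θ (σ k)) +
      slope θ (σ l) * (d - depth θ σ k - min (d - depth θ σ k) (drop θ (σ k))) := by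
  have hs := depth_succ θ σ k
  rcases le_total d (depth θ σ ((k : ℕ) + 1)) with h | h
  · rw [profile_eq hθ σ h1 h, min_eq_left (by linarith)]
    ring
  · have h' := h
    rw [← hkl] at h'
    rw [profile_eq hθ σ h' h2, min_eq_right (by linarith), hkl, pathVertex_succ, depth_succ,
      Complex.add_re, sideVec_re hθ]
    ring

/-! ### Coordinates on a tile -/

/-- The vertical component along the direction `t.lo` of the displacement from the top of `t`. -/
def Tile.loDrop (θ : Fin n → ℝ) (t : Tile n) (p : ℂ) : ℝ :=
  (slope θ t.hi * (t.top.im - p.im) - (p.re - t.top.re)) / (slope θ t.hi - slope θ t.lo)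

/-- The vertical component along the direction `t.hi` of the displacement from the top of `t`. -/
def Tile.hiDrop (θ : Fin n → ℝ) (t : Tile n) (p : ℂ) : ℝ :=
  ((p.re - t.top.re) - slope θ t.lo * (t.top.im - p.im)) / (slope θ t.hi - slope θ t.lo)

namespace Tile

lemma slope_sub_pos (hθ : IsDirections θ) (t : Tile n) : 0 < slope θ t.hi - slope θ t.lo :=
  sub_pos.2 (slope_strictMono hθ t.lo_lt_hi)

lemma loDrop_add_hiDrop (hθ : IsDirections θ) (t : Tile n) (p : ℂ) :
    t.loDrop θ p + t.hiDrop θ p = t.top.im - p.im := by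
  have := (t.slope_sub_pos hθ).ne'
  unfold loDrop hiDrop
  field_simp
  ring

lemma slope_mul_add (hθ : IsDirections θ) (t : Tile n) (p : ℂ) :
    slope θ t.lo * t.loDrop θ p + slope θ t.hi * t.hiDrop θ p = p.re - t.top.re := by
  have := (t.slope_sub_pos hθ).ne'
  unfold loDrop hiDrop
  field_simp
  ring

lemma loDrop_top_add (hθ : IsDirections θ) (t : Tile n) (a b : ℝ) :
    t.loDrop θ (t.top + a • sideVec θ t.lo + b • sideVec θ t.hi) = a * drop θ t.lo := by
  have := (t.slope_sub_pos hθ).ne'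
  unfold loDrop
  simp [sideVec_re hθ, sideVec_im]
  field_simp
  ring

lemma hiDrop_top_add (hθ : IsDirections θ) (t : Tile n) (a b : ℝ) :
    t.hiDrop θ (t.top + a • sideVec θ t.lo + b • sideVec θ t.hi) = b * drop θ t.hi := by
  have := (t.slope_sub_pos hθ).ne'
  unfold hiDrop
  simp [sideVec_re hθ, sideVec_im]
  field_simp
  ring

lemma eq_top_add (hθ : IsDirections θ) (t : Tile n) (p : ℂ) :
    p = t.top + (t.loDrop θ p / drop θ t.lo) • sideVec θ t.lo +
      (t.hiDrop θ p / drop θ t.hi) • sideVec θ t.hi := by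
  have h1 := (drop_pos hθ t.lo).ne'
  have h2 := (drop_pos hθ t.hi).ne'
  have e1 := t.loDrop_add_hiDrop hθ p
  have e2 := t.slope_mul_add hθ p
  apply Complex.ext
  · simp [sideVec_re hθ]
    field_simp
    linarith
  · simp [sideVec_im]
    field_simp
    linarith

lemma mem_region (hθ : IsDirections θ) (t : Tile n) (p : ℂ) :
    p ∈ t.region θ ↔ (0 ≤ t.loDrop θ p ∧ t.loDrop θ p ≤ drop θ t.lo) ∧
      0 ≤ t.hiDrop θ p ∧ t.hiDrop θ p ≤ drop θ t.hi := by
  have h1 := drop_pos hθ t.lo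
  have h2 := drop_pos hθ t.hi
  constructor
  · rintro ⟨a, ⟨ha0, ha1⟩, b, ⟨hb0, hb1⟩, rfl⟩
    rw [loDrop_top_add hθ, hiDrop_top_add hθ]
    refine ⟨⟨?_, ?_⟩, ?_, ?_⟩ <;> nlinarith
  · rintro ⟨⟨h3, h4⟩, h5, h6⟩
    exact ⟨_, ⟨div_nonneg h3 h1.le, (div_le_one h1).2 h4⟩, _,
      ⟨div_nonneg h5 h2.le, (div_le_one h2).2 h6⟩, t.eq_top_add hθ p⟩

end Tile

lemma mem_region_iff_profile (hθ : IsDirections θ) (σ : Equiv.Perm (Fin n)) {k l : Fin n}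
    (hkl : (l : ℕ) = k + 1) {t : Tile n} (ht : t.top = pathVertex θ σ k) (hlo : t.lo = σ l)
    (hhi : t.hi = σ k) (p : ℂ) :
    p ∈ t.region θ ↔ (depth θ σ k ≤ -p.im ∧ -p.im ≤ depth θ σ ((l : ℕ) + 1)) ∧
      profile θ (σ * Equiv.swap k l) (-p.im) ≤ p.re ∧ p.re ≤ profile θ σ (-p.im) := by
  have hpos := t.slope_sub_pos hθ
  have e1 := t.loDrop_add_hiDrop hθ p
  have e2 := t.slope_mul_add hθ p
  have hl := drop_pos hθ t.lo
  have hh := drop_pos hθ t.hi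
  have htop : depth θ σ k = -t.top.im := by rw [ht, depth]
  have hend : depth θ σ ((l : ℕ) + 1) = -t.top.im + drop θ t.hi + drop θ t.lo := by
    rw [depth_succ, hkl, depth_succ, htop, hlo, hhi]
  rw [Tile.mem_region hθ]
  have e3 : ∀ h1 : depth θ σ k ≤ -p.im, ∀ h2 : -p.im ≤ depth θ σ ((l : ℕ) + 1),
      (profile θ (σ * Equiv.swap k l) (-p.im) ≤ p.re ↔
        0 ≤ t.hiDrop θ p ∧ t.loDrop θ p ≤ drop θ t.lo) ∧
      (p.re ≤ profile θ σ (-p.im) ↔ 0 ≤ t.loDrop θ p ∧ t.hiDrop θ p ≤ drop θ t.hi) := by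
    intro h1 h2
    have hk : (k : ℕ) ≠ l := by omega
    rw [profile_two_sides hθ σ hkl h1 h2, profile_two_sides hθ (σ * Equiv.swap k l) hkl
      (by rwa [depth_mul_swap σ hkl hk]) (by rwa [depth_mul_swap σ hkl (by omega)]),
      depth_mul_swap σ hkl hk, pathVertex_mul_swap σ hkl hk, Equiv.Perm.mul_apply,
      Equiv.Perm.mul_apply, Equiv.swap_apply_left, Equiv.swap_apply_right, htop, ← ht, ← hlo,
      ← hhi]
    have hu : -p.im - -t.top.im = t.loDrop θ p + t.hiDrop θ p := by rw [e1]; ring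
    rw [hu]
    generalize t.loDrop θ p = α at *
    generalize t.hiDrop θ p = β at *
    constructor
    -- In tile coordinates, lying on the correct side of a path is one comparison with a `min`,
    -- scaled by the positive difference of slopes.
    · have : (0 ≤ β ∧ α ≤ drop θ t.lo) ↔ α ≤ min (α + β) (drop θ t.lo) := by
        rw [le_min_iff, le_add_iff_nonneg_right]
      rw [this]
      generalize min (α + β) _ = μ
      constructor
      · intro h
        exact le_of_mul_le_mul_left (by linarith) hpos
      · intro h
        have := mul_le_mul_of_nonneg_left h hpos.le
        linarith
    · have : (0 ≤ α ∧ β ≤ drop θ t.hi) ↔ β ≤ min (α + β) (drop θ t.hi) := by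
        rw [le_min_iff, le_add_iff_nonneg_left]
      rw [this]
      generalize min (α + β) _ = μ
      constructor
      · intro h
        exact le_of_mul_le_mul_left (by linarith) hpos
      · intro h
        have := mul_le_mul_of_nonneg_left h hpos.le
        linarith
  constructor
  · rintro ⟨⟨h1, h2⟩, h3, h4⟩
    have h5 : depth θ σ k ≤ -p.im := by linarith
    have h6 : -p.im ≤ depth θ σ ((l : ℕ) + 1) := by linarith
    exact ⟨⟨h5, h6⟩, (e3 h5 h6).1.2 ⟨h3, h2⟩, (e3 h5 h6).2.2 ⟨h1, h4⟩⟩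
  · rintro ⟨⟨h5, h6⟩, h3, h4⟩
    obtain ⟨h7, h8⟩ := (e3 h5 h6).1.1 h3
    obtain ⟨h9, h10⟩ := (e3 h5 h6).2.1 h4
    exact ⟨⟨h9, h8⟩, h7, h10⟩

/-! ### Horizontal order of disjoint convex sets and of tiles -/

lemma exists_pos_add_smul_mem {U : Set ℂ} (hU : IsOpen U) {p : ℂ} (hp : p ∈ U) (v : ℂ) :
    ∃ ε : ℝ, 0 < ε ∧ ∀ δ : ℝ, 0 ≤ δ → δ < ε → p + δ • v ∈ U := by
  have hc : Continuous fun δ : ℝ => p + δ • v := by fun_prop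
  obtain ⟨ε, hε, h⟩ := Metric.isOpen_iff.1 (hU.preimage hc) 0 (by simpa using hp)
  refine ⟨ε, hε, fun δ h0 h1 => h ?_⟩
  rw [Metric.mem_ball, Real.dist_eq, sub_zero, abs_of_nonneg h0]
  exact h1

lemma exists_mem_im_eq {C : Set ℂ} (hC : Convex ℝ C) {p q : ℂ} (hp : p ∈ C) (hq : q ∈ C) {y : ℝ}
    (h1 : p.im ≤ y) (h2 : y ≤ q.im) : ∃ r ∈ C, r.im = y :=
  (hC.linear_image Complex.imLm).ordConnected.out ⟨p, hp, rfl⟩ ⟨q, hq, rfl⟩ ⟨h1, h2⟩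

/-- Disjoint convex sets are in the same horizontal order at all heights. -/
lemma re_lt_re_of_disjoint {C D : Set ℂ} (hC : Convex ℝ C) (hD : Convex ℝ D) (hCD : Disjoint C D)
    {p₁ p₂ q₁ q₂ : ℂ} (hp₁ : p₁ ∈ C) (hp₂ : p₂ ∈ C) (hq₁ : q₁ ∈ D) (hq₂ : q₂ ∈ D)
    (h₁ : p₁.im = q₁.im) (h₂ : p₂.im = q₂.im) (hlt : p₁.re < q₁.re) : p₂.re < q₂.re := by
  by_contra! hle
  have hpos : 0 < (q₁.re - p₁.re) + (p₂.re - q₂.re) := by linarith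
  -- The signed horizontal gap is affine between the two heights; these weights locate its zero, a
  -- common point of `C` and `D`.
  set a := (p₂.re - q₂.re) / ((q₁.re - p₁.re) + (p₂.re - q₂.re))
  set b := (q₁.re - p₁.re) / ((q₁.re - p₁.re) + (p₂.re - q₂.re))
  have ha : 0 ≤ a := div_nonneg (by linarith) hpos.le
  have hb : 0 ≤ b := div_nonneg (by linarith) hpos.le
  have hab : a + b = 1 := by
    rw [← add_div, add_comm (p₂.re - q₂.re)]
    exact div_self hpos.ne'
  have heq : a • p₁ + b • p₂ = a • q₁ + b • q₂ := by
    apply Complex.ext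
    · simp only [Complex.add_re, Complex.real_smul, Complex.mul_re, Complex.ofReal_re,
        Complex.ofReal_im, zero_mul, sub_zero]
      simp only [a, b]
      field_simp
      ring
    · simp [h₁, h₂]
  exact Set.disjoint_left.1 hCD (hC hp₁ hp₂ ha hb hab) (heq ▸ hD hq₁ hq₂ ha hb hab)

namespace Tile

lemma continuous_loDrop (t : Tile n) : Continuous (t.loDrop θ) := by
  have h1 := Complex.continuous_re
  have h2 := Complex.continuous_im
  unfold loDrop
  exact ((continuous_const.mul (continuous_const.sub h2)).sub (h1.sub continuous_const)).div_const _

lemma continuous_hiDrop (t : Tile n) : Continuous (t.hiDrop θ) := by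
  have h1 := Complex.continuous_re
  have h2 := Complex.continuous_im
  unfold hiDrop
  exact ((h1.sub continuous_const).sub (continuous_const.mul (continuous_const.sub h2))).div_const _

lemma isClosed_region (hθ : IsDirections θ) (t : Tile n) : IsClosed (t.region θ) := by
  have : t.region θ = t.loDrop θ ⁻¹' Set.Icc 0 (drop θ t.lo) ∩
      t.hiDrop θ ⁻¹' Set.Icc 0 (drop θ t.hi) := Set.ext fun p => t.mem_region hθ p
  rw [this]
  exact (isClosed_Icc.preimage t.continuous_loDrop).inter
    (isClosed_Icc.preimage t.continuous_hiDrop)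

lemma convex_region (θ : Fin n → ℝ) (t : Tile n) : Convex ℝ (t.region θ) := by
  rintro _ ⟨a, ha, b, hb, rfl⟩ _ ⟨a', ha', b', hb', rfl⟩ x y hx hy hxy
  refine ⟨x * a + y * a', convex_Icc 0 1 ha ha' hx hy hxy,
    x * b + y * b', convex_Icc 0 1 hb hb' hx hy hxy, ?_⟩
  have : t.top = x • t.top + y • t.top := by rw [← add_smul, hxy, one_smul]
  simp only [smul_add, add_smul, mul_smul]
  nth_rewrite 3 [this]
  abel

lemma mem_interior (hθ : IsDirections θ) (t : Tile n) {p : ℂ} (h1 : 0 < t.loDrop θ p)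
    (h2 : t.loDrop θ p < drop θ t.lo) (h3 : 0 < t.hiDrop θ p)
    (h4 : t.hiDrop θ p < drop θ t.hi) : p ∈ interior (t.region θ) := by
  refine interior_maximal (s := t.region θ) (t := t.loDrop θ ⁻¹' Set.Ioo 0 (drop θ t.lo) ∩
      t.hiDrop θ ⁻¹' Set.Ioo 0 (drop θ t.hi)) (fun q hq => ?_) ?_ ⟨⟨h1, h2⟩, h3, h4⟩
  · exact (t.mem_region hθ q).2 ⟨⟨hq.1.1.le, hq.1.2.le⟩, hq.2.1.le, hq.2.2.le⟩
  · exact (isOpen_Ioo.preimage t.continuous_loDrop).inter (isOpen_Ioo.preimage t.continuous_hiDrop)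

lemma nonempty_interior (hθ : IsDirections θ) (t : Tile n) : (interior (t.region θ)).Nonempty := by
  have h1 := drop_pos hθ t.lo
  have h2 := drop_pos hθ t.hi
  refine ⟨t.top + (1 / 2 : ℝ) • sideVec θ t.lo + (1 / 2 : ℝ) • sideVec θ t.hi,
    t.mem_interior hθ ?_ ?_ ?_ ?_⟩ <;>
  simp only [loDrop_top_add hθ, hiDrop_top_add hθ] <;> linarith

lemma closure_interior (hθ : IsDirections θ) (t : Tile n) :
    closure (interior (t.region θ)) = t.region θ := by
  rw [(t.convex_region θ).closure_interior_eq_closure_of_nonempty_interior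
    (t.nonempty_interior hθ), (t.isClosed_region hθ).closure_eq]

lemma top_mem_region (t : Tile n) : t.top ∈ t.region θ :=
  ⟨0, by simp, 0, by simp, by simp⟩

lemma im_le_of_mem_region (hθ : IsDirections θ) (t : Tile n) {p : ℂ} (hp : p ∈ t.region θ) :
    p.im ≤ t.top.im := by
  obtain ⟨⟨h1, -⟩, h2, -⟩ := (t.mem_region hθ p).1 hp
  have := t.loDrop_add_hiDrop hθ p
  linarith

lemma im_lt_of_mem_interior (hθ : IsDirections θ) (t : Tile n) {p : ℂ}
    (hp : p ∈ interior (t.region θ)) : p.im < t.top.im := by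
  obtain ⟨ε, hε, h⟩ := exists_pos_add_smul_mem isOpen_interior hp Complex.I
  have := t.im_le_of_mem_region hθ (interior_subset (h (ε / 2) (by linarith) (by linarith)))
  simp at this
  linarith

lemma exists_mem_interior_lt_im (hθ : IsDirections θ) (t : Tile n) {y : ℝ} (hy : y < t.top.im) :
    ∃ p ∈ interior (t.region θ), y < p.im := by
  have h := t.top_mem_region (θ := θ)
  rw [← t.closure_interior hθ, mem_closure_iff] at h
  obtain ⟨p, hp1, hp2⟩ := h {p | y < p.im} (isOpen_lt continuous_const Complex.continuous_im) hy
  exact ⟨p, hp2, hp1⟩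

lemma loDrop_add_ofReal (t : Tile n) (p : ℂ) (δ : ℝ) :
    t.loDrop θ (p + δ) = t.loDrop θ p - δ / (slope θ t.hi - slope θ t.lo) := by
  unfold loDrop
  rw [← sub_div]
  simp
  ring

lemma hiDrop_add_ofReal (t : Tile n) (p : ℂ) (δ : ℝ) :
    t.hiDrop θ (p + δ) = t.hiDrop θ p + δ / (slope θ t.hi - slope θ t.lo) := by
  unfold hiDrop
  rw [← add_div]
  simp
  ring

/-- No edge is horizontal: moving right strictly decreases `loDrop` and strictly increases `hiDrop`.
-/
lemma mem_interior_of_between (hθ : IsDirections θ) (t : Tile n) {p : ℂ} {δ ε : ℝ}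
    (hp : p ∈ t.region θ) (hq : p + (ε : ℂ) ∈ t.region θ) (hδ : 0 < δ) (hδε : δ < ε) :
    p + (δ : ℂ) ∈ interior (t.region θ) := by
  rw [t.mem_region hθ] at hp hq
  rw [loDrop_add_ofReal, hiDrop_add_ofReal] at hq
  have hpos := t.slope_sub_pos hθ
  have h1 : 0 < δ / (slope θ t.hi - slope θ t.lo) := div_pos hδ hpos
  have h2 : δ / (slope θ t.hi - slope θ t.lo) < ε / (slope θ t.hi - slope θ t.lo) :=
    div_lt_div_of_pos_right hδε hpos
  refine t.mem_interior hθ ?_ ?_ ?_ ?_ <;> simp only [loDrop_add_ofReal, hiDrop_add_ofReal] <;>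
    linarith [hp.1.1, hp.1.2, hp.2.1, hp.2.2, hq.1.1, hq.1.2, hq.2.1, hq.2.2]

/-- Some interior points of `s` and `t` lie at the same height, that of `s` being on the left. -/
def LeftOf (θ : Fin n → ℝ) (s t : Tile n) : Prop :=
  ∃ p ∈ interior (s.region θ), ∃ q ∈ interior (t.region θ), p.im = q.im ∧ p.re < q.re

/-- The two comparisons may occur at different heights. Since the top of `s` is lowest, `r` or `t`
reaches up to the higher of them, and disjointness carries the lower comparison there. -/
lemma LeftOf.trans (hθ : IsDirections θ) {r s t : Tile n}
    (hrs : Disjoint (interior (r.region θ)) (interior (s.region θ)))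
    (hst : Disjoint (interior (s.region θ)) (interior (t.region θ)))
    (h1 : r.LeftOf θ s) (h2 : s.LeftOf θ t) (hr : s.top.im ≤ r.top.im)
    (ht : s.top.im ≤ t.top.im) : r.LeftOf θ t := by
  obtain ⟨p, hp, q, hq, hpq, hlt⟩ := h1
  obtain ⟨p', hp', q', hq', hpq', hlt'⟩ := h2
  have hcr := (r.convex_region θ).interior
  have hcs := (s.convex_region θ).interior
  have hct := (t.convex_region θ).interior
  rcases le_total q.im p'.im with h | h
  · obtain ⟨x, hx, hx'⟩ := r.exists_mem_interior_lt_im hθ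
      ((s.im_lt_of_mem_interior hθ hp').trans_le hr)
    obtain ⟨z, hz, hz'⟩ := exists_mem_im_eq hcr hp hx (hpq.le.trans h) hx'.le
    have := re_lt_re_of_disjoint hcr hcs hrs hp hz hq hp' hpq hz' hlt
    exact ⟨z, hz, q', hq', hz'.trans hpq', this.trans hlt'⟩
  · obtain ⟨x, hx, hx'⟩ := t.exists_mem_interior_lt_im hθ
      ((s.im_lt_of_mem_interior hθ hq).trans_le ht)
    obtain ⟨z, hz, hz'⟩ := exists_mem_im_eq hct hq' hx (hpq'.symm.le.trans h) hx'.le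
    have := re_lt_re_of_disjoint hcs hct hst hp' hq hq' hz hpq' hz'.symm hlt'
    exact ⟨p, hp, z, hz, hpq.trans hz'.symm, hlt.trans this⟩

/-- Set aside the tile `s` with the lowest top and take a rightmost tile `m` of the others. If `m`
is left of `s`, restricted transitivity makes `s` rightmost; otherwise `m` still is. -/
lemma exists_not_leftOf (hθ : IsDirections θ) (T : Finset (Tile n)) (hT : T.Nonempty)
    (hdisj : ∀ s ∈ T, ∀ t ∈ T, s ≠ t →
      Disjoint (interior (s.region θ)) (interior (t.region θ))) :
    ∃ t ∈ T, ∀ s ∈ T, s ≠ t → ¬t.LeftOf θ s := by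
  classical
  induction T using Finset.strongInduction with
  | H T ih =>
  obtain ⟨s, hs, hmin⟩ := T.exists_min_image (fun t => t.top.im) hT
  rcases (T.erase s).eq_empty_or_nonempty with h | h
  · refine ⟨s, hs, fun t ht hts => ?_⟩
    exact absurd (Finset.mem_erase.2 ⟨hts, ht⟩) (by simp [h])
  · obtain ⟨m, hm, hmax⟩ := ih _ (Finset.erase_ssubset hs) h fun a ha b hb =>
      hdisj a (Finset.mem_of_mem_erase ha) b (Finset.mem_of_mem_erase hb)
    have hmT := Finset.mem_of_mem_erase hm
    have hms := Finset.ne_of_mem_erase hm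
    by_cases hl : m.LeftOf θ s
    · refine ⟨s, hs, fun t ht hts hst => ?_⟩
      by_cases htm : t = m
      · subst htm
        obtain ⟨p, hp, q, hq, h1, h2⟩ := hl
        obtain ⟨p', hp', q', hq', h1', h2'⟩ := hst
        have := re_lt_re_of_disjoint (t.convex_region θ).interior (s.convex_region θ).interior
          (hdisj t ht s hs hts) hp hq' hq hp' h1 h1'.symm h2
        exact lt_asymm this h2'
      · exact hmax t (Finset.mem_erase.2 ⟨hts, ht⟩) htm
          (hl.trans hθ (hdisj m hmT s hs hms) (hdisj s hs t ht hts.symm) hst (hmin m hmT)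
            (hmin t ht))
    · refine ⟨m, hmT, fun t ht htm => ?_⟩
      by_cases hts : t = s
      · rwa [hts]
      · exact hmax t (Finset.mem_erase.2 ⟨hts, ht⟩) htm

lemma isClosed_biUnion_region (hθ : IsDirections θ) (T : Finset (Tile n)) :
    IsClosed (⋃ t ∈ T, t.region θ) :=
  T.finite_toSet.isClosed_biUnion fun t _ => t.isClosed_region hθ

/-- The finitely many closed tiles that miss `p` also miss a neighbourhood of it. -/
lemma exists_mem_region_of_ray (hθ : IsDirections θ) (T : Finset (Tile n)) {p v : ℂ} {ε : ℝ}
    (hε : 0 < ε) (h : ∀ δ : ℝ, 0 < δ → δ < ε → p + δ • v ∈ ⋃ t ∈ T, t.region θ) :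
    ∃ t ∈ T, p ∈ t.region θ ∧ ∃ δ : ℝ, 0 < δ ∧ δ < ε ∧ p + δ • v ∈ t.region θ := by
  classical
  have hp : p ∈ (⋃ t ∈ T.filter (fun t => p ∉ t.region θ), t.region θ)ᶜ := by
    simp only [Set.mem_compl_iff, Set.mem_iUnion, Finset.mem_filter, not_exists]
    exact fun t ht => ht.2
  obtain ⟨η, hη, h'⟩ := exists_pos_add_smul_mem (isClosed_biUnion_region hθ _).isOpen_compl hp v
  have hpos : 0 < min ε η / 2 := half_pos (lt_min hε hη)
  have hle : min ε η / 2 < min ε η := half_lt_self (lt_min hε hη)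
  have h1 := h _ hpos (hle.trans_le (min_le_left _ _))
  have h2 := h' _ hpos.le (hle.trans_le (min_le_right _ _))
  simp only [Set.mem_iUnion] at h1
  obtain ⟨t, ht, hmem⟩ := h1
  refine ⟨t, ht, ?_, _, hpos, hle.trans_le (min_le_left _ _), hmem⟩
  by_contra hpt
  exact h2 (Set.mem_biUnion (Finset.mem_coe.2 (Finset.mem_filter.2 ⟨ht, hpt⟩)) hmem)

end Tile

/-! ### Exchanging two consecutive sides of a path -/

lemma symm_mul_swap (σ : Equiv.Perm (Fin n)) (k l x : Fin n) :
    (σ * Equiv.swap k l).symm x = Equiv.swap k l (σ.symm x) := rfl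

/-- An adjacent exchange changes the relative order of only one pair of values, and that pair was an
inversion. -/
lemma symm_lt_symm_of_mul_swap {σ : Equiv.Perm (Fin n)} {k l : Fin n} (hkl : (l : ℕ) = k + 1)
    (hlt : σ l < σ k) {x y : Fin n} (hxy : x < y)
    (h : (σ * Equiv.swap k l).symm y < (σ * Equiv.swap k l).symm x) :
    σ.symm y < σ.symm x := by
  rw [symm_mul_swap, symm_mul_swap] at h
  by_contra! hle
  have hkl' : k < l := Fin.lt_def.2 (by omega)
  obtain ⟨a, rfl⟩ := σ.surjective x
  obtain ⟨b, rfl⟩ := σ.surjective y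
  simp only [Equiv.symm_apply_apply] at h hle
  have hne : ¬(a = k ∧ b = l) := by
    rintro ⟨rfl, rfl⟩
    exact lt_asymm hxy hlt
  rw [Equiv.swap_apply_def, Equiv.swap_apply_def] at h
  split_ifs at h <;> simp only [Fin.ext_iff, Fin.lt_def, Fin.le_def] at * <;> omega

/-- The pairs of values that form an inversion. -/
def inversions (σ : Equiv.Perm (Fin n)) : Finset (Fin n × Fin n) :=
  Finset.univ.filter fun p => p.1 < p.2 ∧ σ.symm p.2 < σ.symm p.1

lemma card_inversions_mul_swap_lt {σ : Equiv.Perm (Fin n)} {k l : Fin n}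
    (hkl : (l : ℕ) = k + 1) (hlt : σ l < σ k) :
    (inversions (σ * Equiv.swap k l)).card < (inversions σ).card := by
  have hkl' : k < l := Fin.lt_def.2 (by omega)
  refine Finset.card_lt_card (Finset.ssubset_iff_of_subset ?_ |>.2 ⟨(σ l, σ k), ?_, ?_⟩)
  · rintro ⟨x, y⟩ h
    simp only [inversions, Finset.mem_filter, Finset.mem_univ, true_and] at h ⊢
    exact ⟨h.1, symm_lt_symm_of_mul_swap hkl hlt h.1 h.2⟩
  · simp [inversions, hlt, hkl']
  · intro h
    have h' := (Finset.mem_filter.1 h).2.2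
    simp only [symm_mul_swap, Equiv.symm_apply_apply, Equiv.swap_apply_left,
      Equiv.swap_apply_right] at h'
    exact lt_asymm h' hkl'

/-- Walk right from `i` along ascents until the first descent. The bound `σ i ≤ σ k` lets
`exists_avoiding` pick descents with a large upper value. -/
lemma exists_adjacent_descent {σ : Equiv.Perm (Fin n)} {i j : Fin n} (hij : i < j)
    (hlt : σ j < σ i) :
    ∃ k l : Fin n, (l : ℕ) = k + 1 ∧ σ l < σ k ∧ σ i ≤ σ k := by
  obtain ⟨d, hd⟩ : ∃ d, (j : ℕ) - i = d := ⟨_, rfl⟩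
  induction d generalizing i with
  | zero => rw [Fin.lt_def] at hij; omega
  | succ d ih =>
    rw [Fin.lt_def] at hij
    obtain ⟨i', hi'⟩ : ∃ i' : Fin n, (i' : ℕ) = i + 1 := ⟨⟨i + 1, by omega⟩, rfl⟩
    by_cases h : σ i' < σ i
    · exact ⟨i, i', hi', h, le_rfl⟩
    · push Not at h
      have hne : (i' : ℕ) ≠ j := fun e => absurd hlt (not_lt.2 (Fin.ext e ▸ h))
      obtain ⟨k, l, h1, h2, h3⟩ := ih (Fin.lt_def.2 (by omega)) (hlt.trans_le h) (by omega)
      exact ⟨k, l, h1, h2, h.trans h3⟩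

lemma profile_mul_swap_le (hθ : IsDirections θ) {σ : Equiv.Perm (Fin n)} {k l : Fin n}
    (hkl : (l : ℕ) = k + 1) (hlt : σ l < σ k) {d : ℝ} (h0 : 0 ≤ d) (h1 : d ≤ height θ) :
    profile θ (σ * Equiv.swap k l) d ≤ profile θ σ d := by
  by_cases hd : depth θ σ k ≤ d ∧ d ≤ depth θ σ ((l : ℕ) + 1)
  · obtain ⟨h2, h3⟩ := hd
    have hk : (k : ℕ) ≠ l := by omega
    have hm := slope_strictMono hθ hlt
    have hsk := depth_succ θ σ k
    have hsl := depth_succ θ σ l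
    have hdk := drop_pos hθ (σ k)
    have hdl := drop_pos hθ (σ l)
    rw [profile_two_sides hθ σ hkl h2 h3, profile_two_sides hθ (σ * Equiv.swap k l) hkl
      (by rwa [depth_mul_swap σ hkl hk]) (by rwa [depth_mul_swap σ hkl (by omega)]),
      depth_mul_swap σ hkl hk, pathVertex_mul_swap σ hkl hk, Equiv.Perm.mul_apply,
      Equiv.Perm.mul_apply, Equiv.swap_apply_left, Equiv.swap_apply_right]
    rw [← hkl] at hsk
    have hu : d - depth θ σ k ≤ drop θ (σ k) + drop θ (σ l) := by linarith
    have hu0 : 0 ≤ d - depth θ σ k := by linarith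
    generalize d - depth θ σ k = u at *
    have key : 0 ≤ min u (drop θ (σ k)) + min u (drop θ (σ l)) - u := by
      rcases min_choice u (drop θ (σ k)) with e | e <;>
      rcases min_choice u (drop θ (σ l)) with e' | e' <;> rw [e, e'] <;> linarith
    have := mul_nonneg (sub_nonneg.2 hm.le) key
    linarith
  · rw [profile_mul_swap_of_notMem hθ σ hkl h0 h1 hd]

/-- `t` is the tile between the path of `σ` and the path obtained by exchanging its sides in the
consecutive positions `k` and `l`. -/
structure IsCornerTile (θ : Fin n → ℝ) (σ : Equiv.Perm (Fin n)) (k l : Fin n) (t : Tile n) :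
    Prop where
  succ : (l : ℕ) = k + 1
  top : t.top = pathVertex θ σ k
  lo : t.lo = σ l
  hi : t.hi = σ k

namespace IsCornerTile

variable {σ : Equiv.Perm (Fin n)} {k l : Fin n} {t : Tile n}

lemma lt (h : IsCornerTile θ σ k l t) : σ l < σ k := h.lo ▸ h.hi ▸ t.lo_lt_hi

lemma mem_region (hθ : IsDirections θ) (h : IsCornerTile θ σ k l t) (p : ℂ) :
    p ∈ t.region θ ↔ (depth θ σ k ≤ -p.im ∧ -p.im ≤ depth θ σ ((l : ℕ) + 1)) ∧
      profile θ (σ * Equiv.swap k l) (-p.im) ≤ p.re ∧ p.re ≤ profile θ σ (-p.im) :=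
  mem_region_iff_profile hθ σ h.succ h.top h.lo h.hi p

lemma polygon_eq (hθ : IsDirections θ) (h : IsCornerTile θ σ k l t) :
    polygon θ σ = polygon θ (σ * Equiv.swap k l) ∪ t.region θ := by
  ext p
  rw [Set.mem_union, mem_polygon hθ k.pos, mem_polygon hθ k.pos, h.mem_region hθ]
  constructor
  · rintro ⟨h1, h2, h3, h4⟩
    by_cases hd : depth θ σ k ≤ -p.im ∧ -p.im ≤ depth θ σ ((l : ℕ) + 1)
    · rcases le_total p.re (profile θ (σ * Equiv.swap k l) (-p.im)) with h5 | h5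
      · exact Or.inl ⟨h1, h2, h3, h5⟩
      · exact Or.inr ⟨hd, h5, h4⟩
    · rw [profile_mul_swap_of_notMem hθ σ h.succ h1 h2 hd]
      exact Or.inl ⟨h1, h2, h3, h4⟩
  · rintro (⟨h1, h2, h3, h4⟩ | ⟨⟨h1, h2⟩, h3, h4⟩)
    · exact ⟨h1, h2, h3, h4.trans (profile_mul_swap_le hθ h.succ h.lt h1 h2)⟩
    · have h5 : 0 ≤ -p.im := by
        have := depth_mono hθ σ (Nat.zero_le k)
        rw [depth_zero] at this
        linarith
      have h6 : -p.im ≤ height θ := by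
        have := depth_mono hθ σ (show (l : ℕ) + 1 ≤ n from l.2)
        rw [depth_last] at this
        linarith
      exact ⟨h5, h6, (profile_one_le hθ k.pos _ h5 h6).trans h3, h4⟩

lemma notMem_polygon_of_mem_interior (hθ : IsDirections θ) (h : IsCornerTile θ σ k l t) {p : ℂ}
    (hp : p ∈ interior (t.region θ)) : p ∉ polygon θ (σ * Equiv.swap k l) := by
  intro hpoly
  obtain ⟨ε, hε, h'⟩ := exists_pos_add_smul_mem isOpen_interior hp (-1)
  have h1 := (h.mem_region hθ _).1 (interior_subset (h' (ε / 2) (by linarith) (by linarith)))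
  have h2 := (mem_polygon hθ k.pos _ p).1 hpoly
  simp at h1 h2
  linarith [h1.2.1, h2.2.2.2]

end IsCornerTile

/-! ### Tilings up to the leftside boundary -/

/-- The tiles have disjoint interiors, and together with the leftside boundary they cover
exactly the polygon of `σ`. -/
def IsQuasiTiling (θ : Fin n → ℝ) (σ : Equiv.Perm (Fin n)) (T : Finset (Tile n)) : Prop :=
  (⋃ t ∈ T, t.region θ) ∪ leftBoundary θ = polygon θ σ ∧
  ∀ s ∈ T, ∀ t ∈ T, s ≠ t → Disjoint (interior (s.region θ)) (interior (t.region θ))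

lemma leftBoundary_subset_polygon (hθ : IsDirections θ) (hn : 0 < n) (σ : Equiv.Perm (Fin n)) :
    leftBoundary θ ⊆ polygon θ σ := by
  intro p hp
  obtain ⟨h1, h2, h3⟩ := (mem_path hθ hn 1 p).1 hp
  exact (mem_polygon hθ hn σ p).2 ⟨h1, h2, h3.ge, h3 ▸ profile_one_le hθ hn σ h1 h2⟩

lemma IsRhombicTiling.isQuasiTiling (hθ : IsDirections θ) (hn : 0 < n)
    {σ : Equiv.Perm (Fin n)} {T : Finset (Tile n)} (hT : IsRhombicTiling θ σ T) :
    IsQuasiTiling θ σ T :=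
  ⟨by rw [hT.1, Set.union_eq_left]; exact leftBoundary_subset_polygon hθ hn σ, hT.2⟩

namespace IsQuasiTiling

variable {σ : Equiv.Perm (Fin n)} {T : Finset (Tile n)}

lemma region_subset (hT : IsQuasiTiling θ σ T) {t : Tile n} (ht : t ∈ T) :
    t.region θ ⊆ polygon θ σ := fun p hp => by
  rw [← hT.1]
  exact Or.inl (Set.mem_biUnion (Finset.mem_coe.2 ht) hp)

lemma mem_biUnion_of_lt (hθ : IsDirections θ) (hn : 0 < n) (hT : IsQuasiTiling θ σ T) {p : ℂ}
    (hp : p ∈ polygon θ σ) (hlt : profile θ 1 (-p.im) < p.re) : p ∈ ⋃ t ∈ T, t.region θ := by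
  rw [← hT.1] at hp
  refine hp.resolve_right fun h => ?_
  have := ((mem_path hθ hn 1 p).1 h).2.2
  linarith

/-- The polygon of the identity degenerates to the left boundary, which is why quasi-tilings include
that boundary separately. -/
lemma one (hθ : IsDirections θ) (hn : 0 < n) : IsQuasiTiling θ 1 (∅ : Finset (Tile n)) := by
  refine ⟨?_, by simp⟩
  ext p
  simp only [Finset.notMem_empty, Set.iUnion_false, Set.iUnion_empty, Set.empty_union,
    leftBoundary]
  rw [mem_path hθ hn, mem_polygon hθ hn]
  exact ⟨fun ⟨h1, h2, h3⟩ => ⟨h1, h2, h3.ge, h3.le⟩,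
    fun ⟨h1, h2, h3, h4⟩ => ⟨h1, h2, le_antisymm h4 h3⟩⟩

open Classical in
lemma insert (hθ : IsDirections θ) {k l : Fin n} {t : Tile n} (h : IsCornerTile θ σ k l t)
    (hT : IsQuasiTiling θ (σ * Equiv.swap k l) T) : IsQuasiTiling θ σ (insert t T) := by
  have hdisj : ∀ s ∈ T, Disjoint (interior (s.region θ)) (interior (t.region θ)) := by
    intro s hs
    rw [Set.disjoint_left]
    intro p hp hp'
    exact h.notMem_polygon_of_mem_interior hθ hp' (hT.region_subset hs (interior_subset hp))
  constructor
  · rw [h.polygon_eq hθ, ← hT.1, Finset.set_biUnion_insert]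
    ac_rfl
  · intro a ha b hb hab
    rcases Finset.mem_insert.1 ha with hat | haT <;>
      rcases Finset.mem_insert.1 hb with hbt | hbT
    · exact absurd (hat.trans hbt.symm) hab
    · exact hat ▸ (hdisj b hbT).symm
    · exact hbt ▸ hdisj a haT
    · exact hT.2 a haT b hbT hab

open Classical in
-- The other tiles are closures of interiors disjoint from `t`, so they stay in the closed smaller
-- polygon.
lemma erase (hθ : IsDirections θ) {k l : Fin n} {t : Tile n} (h : IsCornerTile θ σ k l t)
    (hT : IsQuasiTiling θ σ T) (ht : t ∈ T) :
    IsQuasiTiling θ (σ * Equiv.swap k l) (T.erase t) := by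
  refine ⟨Set.Subset.antisymm ?_ ?_, fun a ha b hb =>
    hT.2 a (Finset.mem_of_mem_erase ha) b (Finset.mem_of_mem_erase hb)⟩
  · refine Set.union_subset (Set.iUnion₂_subset fun s hs => ?_)
      (leftBoundary_subset_polygon hθ k.pos _)
    obtain ⟨hst, hs⟩ := Finset.mem_erase.1 hs
    rw [← s.closure_interior hθ]
    refine closure_minimal (fun p hp => ?_) (isClosed_polygon hθ k.pos _)
    have hp' := hT.region_subset hs (interior_subset hp)
    rw [h.polygon_eq hθ] at hp'
    refine hp'.resolve_right fun hpt => ?_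
    rw [← t.closure_interior hθ, mem_closure_iff] at hpt
    obtain ⟨q, hq1, hq2⟩ := hpt _ isOpen_interior hp
    exact Set.disjoint_left.1 (hT.2 s hs t ht hst) hq1 hq2
  · intro p hp
    have hp' := (mem_polygon hθ k.pos _ p).1 hp
    have hsub : polygon θ (σ * Equiv.swap k l) ⊆ polygon θ σ := by
      rw [h.polygon_eq hθ]
      exact Set.subset_union_left
    rcases hp'.2.2.1.eq_or_lt with heq | hlt
    · exact Or.inr ((mem_path hθ k.pos 1 p).2 ⟨hp'.1, hp'.2.1, heq.symm⟩)
    left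
    have hmem : ∀ q ∈ polygon θ (σ * Equiv.swap k l), profile θ 1 (-q.im) < q.re →
        q ∉ t.region θ → q ∈ ⋃ s ∈ T.erase t, s.region θ := by
      intro q hq hq1 hqt
      have := hT.mem_biUnion_of_lt hθ k.pos (hsub hq) hq1
      simp only [Set.mem_iUnion] at this ⊢
      obtain ⟨s, hs, hqs⟩ := this
      exact ⟨s, Finset.mem_erase.2 ⟨fun e => hqt (e ▸ hqs), hs⟩, hqs⟩
    -- A point of `t` in the smaller polygon lies on their common border; points just left of it
    -- avoid `t`, so another tile accumulates there.
    by_cases hpt : p ∈ t.region θ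
    · obtain ⟨s, hs, hps, -⟩ := Tile.exists_mem_region_of_ray hθ (T.erase t) (p := p) (v := -1)
        (sub_pos.2 hlt) fun δ hδ hδ' => by
          have him : (p + δ • (-1 : ℂ)).im = p.im := by simp
          have hre : (p + δ • (-1 : ℂ)).re = p.re - δ := by simp; ring
          refine hmem _ ((mem_polygon hθ k.pos _ _).2 ?_) ?_ fun hq => ?_
          · rw [him, hre]
            refine ⟨hp'.1, hp'.2.1, ?_, ?_⟩ <;> linarith [hp'.2.2.2]
          · rw [him, hre]
            linarith
          · have := ((h.mem_region hθ _).1 hq).2.1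
            rw [him, hre] at this
            linarith [hp'.2.2.2]
      exact Set.mem_biUnion (Finset.mem_coe.2 hs) hps
    · exact hmem p hp hlt hpt

/-- Here `p` lies on a right edge of `t`, apart from the top and bottom vertices. If there were room
on its right, another tile would fill it and `t` would be left of that tile. -/
lemma re_eq_profile (hθ : IsDirections θ) (hT : IsQuasiTiling θ σ T) {t : Tile n} (ht : t ∈ T)
    (hmax : ∀ s ∈ T, s ≠ t → ¬t.LeftOf θ s) {p : ℂ} (hp : p ∈ t.region θ)
    (h1 : t.loDrop θ p < drop θ t.lo) (h2 : 0 < t.hiDrop θ p)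
    (h3 : t.loDrop θ p = 0 ∨ t.hiDrop θ p = drop θ t.hi) : p.re = profile θ σ (-p.im) := by
  have hn := t.lo.pos
  have hpoly := hT.region_subset ht hp
  rw [mem_polygon hθ hn] at hpoly
  obtain ⟨hp1, hp2, hp3, hp4⟩ := hpoly
  by_contra hne
  have hlt : p.re < profile θ σ (-p.im) := lt_of_le_of_ne hp4 hne
  obtain ⟨s, hs, hps, ε, hε, -, hε'⟩ := Tile.exists_mem_region_of_ray hθ T (p := p) (v := 1)
    (sub_pos.2 hlt) fun δ hδ hδ' => by
      refine hT.mem_biUnion_of_lt hθ hn ((mem_polygon hθ hn σ _).2 ?_) ?_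
      · simp
        simp at hp1
        refine ⟨hp1, hp2, ?_, ?_⟩ <;> linarith
      · simp
        linarith
  rw [Complex.real_smul, mul_one] at hε'
  have hpos := t.slope_sub_pos hθ
  have hpt := (t.mem_region hθ p).1 hp
  have hst : s ≠ t := by
    rintro rfl
    have := (s.mem_region hθ _).1 hε'
    rw [Tile.loDrop_add_ofReal, Tile.hiDrop_add_ofReal] at this
    have hq : 0 < ε / (slope θ s.hi - slope θ s.lo) := div_pos hε hpos
    rcases h3 with h3 | h3 <;> linarith [this.1.1, this.2.2]
  -- A shift to the left adds `η` to `loDrop` and takes it from `hiDrop`, which enters the interior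
  -- of `t`.
  set η := min (drop θ t.lo - t.loDrop θ p) (t.hiDrop θ p) / 2
  have hη : 0 < η := half_pos (lt_min (by linarith) h2)
  have hη1 : η < drop θ t.lo - t.loDrop θ p :=
    (half_lt_self (lt_min (by linarith) h2)).trans_le (min_le_left _ _)
  have hη2 : η < t.hiDrop θ p :=
    (half_lt_self (lt_min (by linarith) h2)).trans_le (min_le_right _ _)
  have hdiv : -(η * (slope θ t.hi - slope θ t.lo)) / (slope θ t.hi - slope θ t.lo) = -η := by
    field_simp
  refine hmax s hs hst ⟨p + (-(η * (slope θ t.hi - slope θ t.lo)) : ℝ),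
    t.mem_interior hθ ?_ ?_ ?_ ?_, p + (ε / 2 : ℝ),
    s.mem_interior_of_between hθ hps hε' (half_pos hε) (half_lt_self hε), ?_, ?_⟩
  · rw [Tile.loDrop_add_ofReal, hdiv]
    linarith [hpt.1.1]
  · rw [Tile.loDrop_add_ofReal, hdiv]
    linarith
  · rw [Tile.hiDrop_add_ofReal, hdiv]
    linarith
  · rw [Tile.hiDrop_add_ofReal, hdiv]
    linarith [hpt.2.2]
  · rw [Complex.add_im, Complex.add_im, Complex.ofReal_im, Complex.ofReal_im]
  · rw [Complex.add_re, Complex.add_re, Complex.ofReal_re, Complex.ofReal_re]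
    have := mul_pos hη hpos
    linarith

end IsQuasiTiling

/-- A straight part of a path that is as long as the side of the same direction is that side. -/
lemma depth_eq_of_profile_linear (hθ : IsDirections θ) (σ : Equiv.Perm (Fin n)) (k : Fin n)
    {d₀ x₀ : ℝ} (h0 : 0 ≤ d₀) (h1 : d₀ + drop θ (σ k) ≤ height θ)
    (h : ∀ u, 0 < u → u < drop θ (σ k) → profile θ σ (d₀ + u) = x₀ + slope θ (σ k) * u) :
    depth θ σ k = d₀ ∧ (pathVertex θ σ k).re = x₀ := by
  have hpos := drop_pos hθ (σ k)
  have hs := depth_succ θ σ k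
  have key : ∀ d, d₀ < d → d < d₀ + drop θ (σ k) →
      depth θ σ k ≤ d ∧ d < depth θ σ ((k : ℕ) + 1) := by
    intro d hd1 hd2
    obtain ⟨i, hi1, hi2⟩ := exists_depth_le_lt (θ := θ) σ (d := d) (by linarith) (by linarith)
    -- Two depths on the same side `i` determine its slope, and distinct labels have distinct
    -- slopes; hence `i = k`.
    obtain ⟨d', hd'1, hd'2⟩ := exists_between (lt_min hd2 hi2)
    rw [lt_min_iff] at hd'2
    have e1 := h (d - d₀) (by linarith) (by linarith)
    have e2 := h (d' - d₀) (by linarith) (by linarith)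
    rw [add_sub_cancel] at e1 e2
    rw [profile_eq hθ σ hi1 hi2.le] at e1
    rw [profile_eq hθ σ (hi1.trans hd'1.le) hd'2.2.le] at e2
    have e3 : (slope θ (σ i) - slope θ (σ k)) * (d' - d) = 0 := by linarith
    have e4 : slope θ (σ i) = slope θ (σ k) :=
      sub_eq_zero.1 ((mul_eq_zero.1 e3).resolve_right (by linarith))
    have e5 : i = k := σ.injective ((slope_strictMono hθ).injective e4)
    subst e5
    exact ⟨hi1, hi2⟩
  have hdep : depth θ σ k = d₀ := by
    apply le_antisymm
    · by_contra! hlt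
      obtain ⟨d, hd1, hd2⟩ := exists_between (lt_min hlt (lt_add_of_pos_right d₀ hpos))
      rw [lt_min_iff] at hd2
      linarith [(key d hd1 hd2.2).1]
    · by_contra! hlt
      obtain ⟨d, hd1, hd2⟩ := exists_between
        (max_lt (lt_add_of_pos_right d₀ hpos)
          (show depth θ σ ((k : ℕ) + 1) < d₀ + drop θ (σ k) by linarith))
      rw [max_lt_iff] at hd1
      linarith [(key d hd1.1 hd2).2]
  refine ⟨hdep, ?_⟩
  have e := h (drop θ (σ k) / 2) (by linarith) (by linarith)
  rw [profile_eq hθ σ (i := k) (by linarith) (by linarith), hdep] at e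
  linarith

namespace IsQuasiTiling

variable {σ : Equiv.Perm (Fin n)} {T : Finset (Tile n)}

/-- A tile with nothing on its right fits into a corner of the rightside boundary. -/
lemma exists_isCornerTile (hθ : IsDirections θ) (hT : IsQuasiTiling θ σ T) {t : Tile n}
    (ht : t ∈ T) (hmax : ∀ s ∈ T, s ≠ t → ¬t.LeftOf θ s) :
    ∃ k l : Fin n, IsCornerTile θ σ k l t := by
  have hn := t.lo.pos
  have hl := drop_pos hθ t.lo
  have hh := drop_pos hθ t.hi
  have htop := (mem_polygon hθ hn σ _).1 (hT.region_subset ht (t.top_mem_region))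
  have hbot := (mem_polygon hθ hn σ _).1 (hT.region_subset ht
    (show t.top + (1 : ℝ) • sideVec θ t.lo + (1 : ℝ) • sideVec θ t.hi ∈ t.region θ from
      ⟨1, by simp, 1, by simp, rfl⟩))
  simp only [one_smul, Complex.add_im, sideVec_im] at hbot
  have hprof : ∀ α β : ℝ, 0 ≤ α → α < drop θ t.lo → 0 < β → β ≤ drop θ t.hi →
      (α = 0 ∨ β = drop θ t.hi) → profile θ σ (-t.top.im + (α + β)) =
        t.top.re + slope θ t.lo * α + slope θ t.hi * β := by
    intro α β h1 h2 h3 h4 h5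
    have e1 := t.loDrop_top_add hθ (α / drop θ t.lo) (β / drop θ t.hi)
    have e2 := t.hiDrop_top_add hθ (α / drop θ t.lo) (β / drop θ t.hi)
    rw [div_mul_cancel₀ _ hl.ne'] at e1
    rw [div_mul_cancel₀ _ hh.ne'] at e2
    generalize t.top + (α / drop θ t.lo) • sideVec θ t.lo +
      (β / drop θ t.hi) • sideVec θ t.hi = p at e1 e2
    have e3 := t.loDrop_add_hiDrop hθ p
    have e4 := t.slope_mul_add hθ p
    have := hT.re_eq_profile hθ ht hmax (p := p)
      ((t.mem_region hθ p).2 (by rw [e1, e2]; exact ⟨⟨h1, h2.le⟩, h3.le, h4⟩))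
      (by rwa [e1]) (by rwa [e2]) (by rwa [e1, e2])
    rw [e1, e2] at e3 e4
    rw [show -t.top.im + (α + β) = -p.im by linarith, ← this]
    linarith
  obtain ⟨k, hk⟩ := σ.surjective t.hi
  obtain ⟨l, hl'⟩ := σ.surjective t.lo
  obtain ⟨hk1, hk2⟩ := depth_eq_of_profile_linear hθ σ k (d₀ := -t.top.im) (x₀ := t.top.re)
    htop.1 (by rw [hk]; linarith [hbot.2.1]) fun u hu hu' => by
      rw [hk] at hu' ⊢
      have := hprof 0 u le_rfl hl hu hu'.le (Or.inl rfl)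
      rw [zero_add] at this
      rw [this]
      ring
  obtain ⟨hl1, -⟩ := depth_eq_of_profile_linear hθ σ l (d₀ := -t.top.im + drop θ t.hi)
    (x₀ := t.top.re + slope θ t.hi * drop θ t.hi)
    (by linarith [htop.1]) (by rw [hl']; linarith [hbot.2.1]) fun u hu hu' => by
      rw [hl'] at hu' ⊢
      have := hprof u (drop θ t.hi) hu.le hu' hh le_rfl (Or.inr rfl)
      rw [show -t.top.im + drop θ t.hi + u = -t.top.im + (u + drop θ t.hi) by ring, this]
      ring
  have hs := depth_succ θ σ k
  rw [hk, hk1, ← hl1] at hs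
  refine ⟨k, l, ?_, ?_, hl'.symm, hk.symm⟩
  -- Side `l` starts at the depth where side `k` ends, and vertex depths are strictly increasing.
  · rcases lt_trichotomy (l : ℕ) (k + 1) with h | h | h
    · have := depth_lt hθ σ h
      linarith
    · exact h
    · have := depth_lt hθ σ (k := ⟨k + 1, by omega⟩) h
      simp only [hs] at this
      exact absurd this (lt_irrefl _)
  · refine Complex.ext hk2.symm ?_
    rw [depth] at hk1
    linarith

/-- The labels of every tile of a tiling form an inversion. -/
lemma symm_hi_lt_symm_lo (hθ : IsDirections θ) (hT : IsQuasiTiling θ σ T) {t : Tile n}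
    (ht : t ∈ T) : σ.symm t.hi < σ.symm t.lo := by
  classical
  induction hc : T.card generalizing σ T with
  | zero =>
    rw [Finset.card_eq_zero] at hc
    simp [hc] at ht
  | succ c ih =>
    obtain ⟨s, hs, hmax⟩ := Tile.exists_not_leftOf hθ T ⟨t, ht⟩ hT.2
    obtain ⟨k, l, h⟩ := hT.exists_isCornerTile hθ hs hmax
    by_cases hts : t = s
    · rw [hts, h.lo, h.hi, Equiv.symm_apply_apply, Equiv.symm_apply_apply, Fin.lt_def, h.succ]
      omega
    · refine symm_lt_symm_of_mul_swap h.succ h.lt t.lo_lt_hi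
        (ih (hT.erase hθ h hs) (Finset.mem_erase.2 ⟨hts, ht⟩) ?_)
      rw [Finset.card_erase_of_mem hs, hc, Nat.add_sub_cancel]

/-! ### Construction of tilings -/

lemma exists_of_pos (hθ : IsDirections θ) (hn : 0 < n) (σ : Equiv.Perm (Fin n)) :
    ∃ T, IsQuasiTiling θ σ T := by
  classical
  induction hc : (inversions σ).card using Nat.strong_induction_on generalizing σ with
  | _ c ih =>
    by_cases hmono : Monotone σ
    · rw [Equiv.Perm.monotone_iff] at hmono
      exact ⟨∅, hmono ▸ one hθ hn⟩
    · obtain ⟨i, j, hij, hlt⟩ : ∃ i j, i ≤ j ∧ σ j < σ i := by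
        simpa [Monotone] using hmono
      have hij' : i < j := lt_of_le_of_ne hij fun e => by simp [e] at hlt
      obtain ⟨k, l, hkl, hlt', -⟩ := exists_adjacent_descent hij' hlt
      obtain ⟨T, hT⟩ := ih _ (hc ▸ card_inversions_mul_swap_lt hkl hlt') _ rfl
      exact ⟨_, hT.insert hθ (t := ⟨pathVertex θ σ k, σ l, σ k, hlt'⟩) ⟨hkl, rfl, rfl, rfl⟩⟩

lemma pathVertex_ne_zero (hθ : IsDirections θ) (σ : Equiv.Perm (Fin n)) {k : Fin n}
    (hk : (k : ℕ) ≠ 0) : pathVertex θ σ k ≠ 0 := by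
  intro h
  have := depth_lt hθ σ (k := ⟨0, k.pos⟩) (l := k) (Nat.pos_of_ne_zero hk)
  simp only [depth_zero] at this
  rw [depth, h] at this
  simp at this

/-- If `a < b < c` and `b` comes before `a`, then some tiling has no tile with labels `a` and `c`
at the top vertex. -/
lemma exists_avoiding (hθ : IsDirections θ) (σ : Equiv.Perm (Fin n)) {a b c : Fin n}
    (hab : a < b) (hbc : b < c) (hσ : σ.symm b < σ.symm a) :
    ∃ T, IsQuasiTiling θ σ T ∧ ∀ t ∈ T, t.top = 0 → t.lo = a → t.hi ≠ c := by
  classical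
  induction hc : (inversions σ).card using Nat.strong_induction_on generalizing σ with
  | _ m ih =>
    by_cases hex : ∃ i j, i < j ∧ σ j < σ i ∧ b < σ i
    · obtain ⟨i, j, hij, hlt, hb⟩ := hex
      obtain ⟨k, l, hkl, hlt', hle⟩ := exists_adjacent_descent hij hlt
      have hbk : b < σ k := hb.trans_le hle
      -- The exchange could reverse `b` and `a` only if `σ k = b`, but `b < σ k`.
      have hswap : (σ * Equiv.swap k l).symm b < (σ * Equiv.swap k l).symm a := by
        have hkl' : k < l := Fin.lt_def.2 (by omega)
        rw [symm_mul_swap, symm_mul_swap]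
        obtain ⟨x, rfl⟩ := σ.surjective a
        obtain ⟨y, rfl⟩ := σ.surjective b
        simp only [Equiv.symm_apply_apply] at hσ ⊢
        have hyk : y ≠ k := fun e => lt_irrefl _ (e ▸ hbk)
        rw [Equiv.swap_apply_def, Equiv.swap_apply_def]
        split_ifs <;> simp only [Fin.ext_iff, Fin.lt_def, Fin.le_def, ne_eq] at * <;> omega
      obtain ⟨T, hT, hav⟩ := ih _ (hc ▸ card_inversions_mul_swap_lt hkl hlt') _ hswap rfl
      refine ⟨_, hT.insert hθ (t := ⟨pathVertex θ σ k, σ l, σ k, hlt'⟩) ⟨hkl, rfl, rfl, rfl⟩, ?_⟩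
      intro t ht htop hlo hhi
      rcases Finset.mem_insert.1 ht with h | h
      · subst h
        -- A corner tile at the top has `k = 0`, so `a` is in position `1` and `b`, which precedes
        -- it, would be `σ k`.
        simp only at htop hlo hhi
        have hk0 : (k : ℕ) = 0 := by
          by_contra hk
          exact pathVertex_ne_zero hθ σ hk htop
        rw [← hlo, Equiv.symm_apply_apply, Fin.lt_def, hkl] at hσ
        have : σ.symm b = k := Fin.ext (by omega)
        rw [← this, Equiv.apply_symm_apply] at hbk
        exact lt_irrefl _ hbk
      · exact hav t h htop hlo hhi
    · push Not at hex
      obtain ⟨T, hT⟩ := exists_of_pos hθ a.pos σ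
      refine ⟨T, hT, fun t ht _ _ hhi => ?_⟩
      have h := hex _ _ (hT.symm_hi_lt_symm_lo hθ ht) (by simpa using t.lo_lt_hi)
      rw [Equiv.apply_symm_apply, hhi] at h
      exact not_le.2 hbc h

/-- Only the left boundary is in question. Inside each of its sides the polygon has positive width,
so tiles accumulate from the right; the vertices follow by taking closures. -/
lemma isRhombicTiling (hθ : IsDirections θ) (hn : 2 ≤ n) (hσ : FullySupported σ)
    (hT : IsQuasiTiling θ σ T) : IsRhombicTiling θ σ T := by
  have hn' : 0 < n := by omega
  refine ⟨?_, hT.2⟩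
  rw [← hT.1, eq_comm, Set.union_eq_left]
  intro p hp
  obtain ⟨h1, h2, h3⟩ := (mem_path hθ hn' 1 p).1 hp
  obtain ⟨k, hk1, hk2⟩ := exists_depth_le_le hθ hn' 1 h1 h2
  have hcont : Continuous fun d : ℝ => (profile θ 1 d : ℂ) - d * Complex.I := by
    have := continuous_profile θ 1
    fun_prop
  have hclosed := (Tile.isClosed_biUnion_region hθ T).preimage hcont
  have hsub : Set.Ioo (depth θ 1 k) (depth θ 1 ((k : ℕ) + 1)) ⊆
      (fun d : ℝ => (profile θ 1 d : ℂ) - d * Complex.I) ⁻¹' ⋃ t ∈ T, t.region θ := by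
    rintro d ⟨hd1, hd2⟩
    have hd0 : 0 ≤ d := by
      have := depth_mono hθ 1 (Nat.zero_le k)
      rw [depth_zero] at this
      linarith
    have hdH : d ≤ height θ := by
      have := depth_mono hθ 1 (show (k : ℕ) + 1 ≤ n from k.2)
      rw [depth_last] at this
      linarith
    have hlt := profile_one_lt hθ hn hσ hd1 hd2
    obtain ⟨t, ht, hmem, -⟩ := Tile.exists_mem_region_of_ray hθ T
      (p := (profile θ 1 d : ℂ) - d * Complex.I) (v := 1) (sub_pos.2 hlt) fun δ hδ hδ' => by
        refine hT.mem_biUnion_of_lt hθ hn' ((mem_polygon hθ hn' σ _).2 ?_) ?_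
        · simp
          exact ⟨hd0, hdH, hδ.le, by linarith⟩
        · simpa using hδ
    exact Set.mem_biUnion (Finset.mem_coe.2 ht) hmem
  have h4 := closure_minimal hsub hclosed
  rw [closure_Ioo (by linarith [depth_succ θ 1 k, drop_pos hθ ((1 : Equiv.Perm (Fin n)) k)])] at h4
  have h5 := h4 ⟨hk1, hk2⟩
  have h6 : (profile θ 1 (-p.im) : ℂ) - ((-p.im : ℝ) : ℂ) * Complex.I = p := by
    apply Complex.ext <;> simp [h3]
  rwa [Set.mem_preimage, h6] at h5

end IsQuasiTiling

/-! ### Pattern conditions -/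

lemma FullySupported.apply_zero_ne [NeZero n] (hn : 2 ≤ n) {w : Equiv.Perm (Fin n)}
    (hw : FullySupported w) : w 0 ≠ 0 := by
  intro h
  refine hw 1 le_rfl (by omega) ?_
  have : {i : Fin n | (i : ℕ) < 1} = {0} := by
    ext i
    rw [Set.mem_singleton_iff, Fin.ext_iff, Fin.val_zero]
    exact Nat.lt_one_iff
  rw [this, Set.image_singleton, h]

lemma together321_of_lt [NeZero n] {w : Equiv.Perm (Fin n)} {b : Fin n} (h0 : 0 < b)
    (hb : b < w 0) (h : w.symm b < w.symm 0) : Together321 w (w 0) 0 := by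
  refine ⟨0, w.symm b, w.symm 0, ⟨?_, h, ?_, ?_⟩, by simp, by simp⟩
  · rw [Fin.pos_iff_ne_zero]
    intro e
    rw [← e, Equiv.apply_symm_apply] at hb
    exact lt_irrefl _ hb
  · simpa using h0
  · simpa using hb

/-- The first entry can only play the `3`, and the least value only the `1`. -/
lemma Together321.exists_lt [NeZero n] {w : Equiv.Perm (Fin n)}
    (h : Together321 w (w 0) 0) : ∃ b, 0 < b ∧ b < w 0 ∧ w.symm b < w.symm 0 := by
  obtain ⟨i, j, k, ⟨hij, hjk, h1, h2⟩, hw0, h0⟩ := h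
  simp only [Finset.mem_insert, Finset.mem_singleton, EmbeddingLike.apply_eq_iff_eq] at hw0 h0
  have hj : 0 < j := lt_of_le_of_lt (Fin.zero_le i) hij
  have hwj : 0 < w j := lt_of_le_of_lt (Fin.zero_le _) h1
  have hi : i = 0 := by
    rcases hw0 with h | h | h
    · exact h.symm
    · exact absurd h hj.ne
    · exact absurd h (hj.trans hjk).ne
  have hk : w k = 0 := by
    rcases h0 with h | h | h
    · exact absurd h (hwj.trans h2).ne
    · exact absurd h hwj.ne
    · exact h.symm
  refine ⟨w j, hwj, hi ▸ h2, ?_⟩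
  rwa [Equiv.symm_apply_apply, ← hk, Equiv.symm_apply_apply]

lemma not_together321_iff [NeZero n] {w : Equiv.Perm (Fin n)} (h0 : w 0 ≠ 0) :
    ¬Together321 w (w 0) 0 ↔ FirstLRMinAfterFirstIs w 0 := by
  constructor
  · intro h
    refine ⟨w.symm 0, ⟨⟨?_, ?_⟩, ?_⟩, by simp⟩
    · rw [Fin.pos_iff_ne_zero]
      intro e
      apply h0
      rw [← e, Equiv.apply_symm_apply, e]
    · intro j hj
      rw [Equiv.apply_symm_apply, Fin.pos_iff_ne_zero]
      rintro e
      rw [← e, Equiv.symm_apply_apply] at hj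
      exact lt_irrefl _ hj
    · rintro j ⟨hj0, hj⟩
      by_contra! hlt
      refine h (together321_of_lt (b := w j) ?_ (hj 0 hj0) (by simpa using hlt))
      rw [Fin.pos_iff_ne_zero]
      rintro e
      rw [← e, Equiv.symm_apply_apply] at hlt
      exact lt_irrefl _ hlt
  · rintro ⟨i, ⟨-, hleast⟩, hi⟩ h
    obtain ⟨b, -, hb, hlt⟩ := h.exists_lt
    classical
    -- The leftmost entry below `w 0` is a left-to-right minimum, no later than `b` and hence before
    -- `0`.
    have hne : (Finset.univ.filter fun j => w j < w 0 ∧ j ≤ w.symm b).Nonempty :=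
      ⟨w.symm b, by simpa using hb⟩
    obtain ⟨j, hj, hmin⟩ := Finset.exists_min_image _ id hne
    simp only [Finset.mem_filter, Finset.mem_univ, true_and, id] at hj hmin
    have hj0 : 0 < j := by
      rw [Fin.pos_iff_ne_zero]
      rintro rfl
      exact lt_irrefl _ hj.1
    have hle : i ≤ j := hleast ⟨hj0, fun x hx => by
      by_contra! hle
      exact not_le.2 hx (hmin x ⟨hle.trans_lt hj.1, hx.le.trans hj.2⟩)⟩
    rw [← hi, Equiv.symm_apply_apply] at hlt
    exact not_lt.2 (hle.trans hj.2) hlt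

/-! ### Tiles at the top vertex -/

lemma sideVec_injective (hθ : IsDirections θ) : Function.Injective (sideVec θ) := by
  intro i j h
  have him := congrArg Complex.im h
  have hre := congrArg Complex.re h
  rw [sideVec_im, sideVec_im, neg_inj] at him
  rw [sideVec_re hθ, sideVec_re hθ, him] at hre
  exact (slope_strictMono hθ).injective (mul_right_cancel₀ (drop_pos hθ j).ne' hre)

/-- Edges are bare point sets; the highest and lowest points of a segment recover its starting
vertex and its label. -/
lemma eq_and_eq_of_segment_eq (hθ : IsDirections θ) {p q : ℂ} {i j : Fin n}
    (h : segment ℝ p (p + sideVec θ i) = segment ℝ q (q + sideVec θ j)) : p = q ∧ i = j := by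
  have hmem : ∀ (p q : ℂ) (i : Fin n), q ∈ segment ℝ p (p + sideVec θ i) →
      ∃ s : ℝ, 0 ≤ s ∧ s ≤ 1 ∧ q = p + s • sideVec θ i := by
    intro p q i hq
    rw [segment_eq_image', add_sub_cancel_left] at hq
    obtain ⟨s, hs, rfl⟩ := hq
    exact ⟨s, hs.1, hs.2, rfl⟩
  have hi := drop_pos hθ i
  have hj := drop_pos hθ j
  obtain ⟨s, hs0, -, hs⟩ := hmem q p j (h ▸ left_mem_segment ℝ _ _)
  obtain ⟨s', hs0', -, hs'⟩ := hmem p q i (h ▸ left_mem_segment ℝ _ _)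
  have e1 := congrArg Complex.im hs
  have e2 := congrArg Complex.im hs'
  simp [sideVec_im] at e1 e2
  have hp1 := mul_nonneg hs0 hj.le
  have hp2 := mul_nonneg hs0' hi.le
  have hs00 : s = 0 := (mul_eq_zero.1 (show s * drop θ j = 0 by linarith)).resolve_right hj.ne'
  have hpq : p = q := by simpa [hs00] using hs
  subst hpq
  refine ⟨rfl, ?_⟩
  obtain ⟨r, -, hr1, hr⟩ := hmem p _ j (h.subset (right_mem_segment ℝ _ _))
  obtain ⟨r', -, hr1', hr'⟩ := hmem p _ i (h.symm.subset (right_mem_segment ℝ _ _))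
  rw [add_right_inj] at hr hr'
  have e3 := congrArg Complex.im hr
  have e4 := congrArg Complex.im hr'
  simp [sideVec_im] at e3 e4
  have h3 := mul_le_mul_of_nonneg_right hr1 hj.le
  have h4 := mul_le_mul_of_nonneg_right hr1' hi.le
  have hr11 : r = 1 := mul_right_cancel₀ hj.ne' (show r * drop θ j = 1 * drop θ j by linarith)
  rw [hr11, one_smul] at hr
  exact sideVec_injective hθ hr

lemma pathSide_zero [NeZero n] (θ : Fin n → ℝ) (σ : Equiv.Perm (Fin n)) :
    pathSide θ σ 0 = segment ℝ 0 (0 + sideVec θ (σ 0)) := by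
  rw [pathSide, pathVertex_succ, Fin.val_zero, pathVertex_zero]

lemma IsTopPerimeter.top_lo_hi [NeZero n] (hθ : IsDirections θ) {w : Equiv.Perm (Fin n)}
    (hw : w 0 ≠ 0) {t : Tile n} (ht : IsTopPerimeter θ w t) :
    t.top = 0 ∧ t.lo = 0 ∧ t.hi = w 0 := by
  have hedge : ∀ i, segment ℝ 0 (0 + sideVec θ i) ∈ t.edges θ →
      ((t.top = 0 ∨ t.top + sideVec θ t.hi = 0) ∧ t.lo = i) ∨
        ((t.top = 0 ∨ t.top + sideVec θ t.lo = 0) ∧ t.hi = i) := by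
    intro i hi
    simp only [Tile.edges, Set.mem_insert_iff, Set.mem_singleton_iff] at hi
    rcases hi with h | h | h | h
    · obtain ⟨h1, h2⟩ := eq_and_eq_of_segment_eq hθ h
      exact Or.inl ⟨Or.inl h1.symm, h2.symm⟩
    · obtain ⟨h1, h2⟩ := eq_and_eq_of_segment_eq hθ h
      exact Or.inr ⟨Or.inl h1.symm, h2.symm⟩
    · obtain ⟨h1, h2⟩ := eq_and_eq_of_segment_eq hθ h
      exact Or.inr ⟨Or.inr h1.symm, h2.symm⟩
    · rw [add_right_comm] at h
      obtain ⟨h1, h2⟩ := eq_and_eq_of_segment_eq hθ h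
      exact Or.inl ⟨Or.inr h1.symm, h2.symm⟩
  obtain ⟨h1, h2⟩ := ht
  rw [pathSide_zero] at h1 h2
  have hlt := t.lo_lt_hi
  rcases hedge _ h1 with ⟨ha, hlo⟩ | ⟨-, hhi⟩
  · rw [Equiv.Perm.one_apply] at hlo
    rcases hedge _ h2 with ⟨-, hlo'⟩ | ⟨hb, hhi⟩
    · exact absurd (hlo'.symm.trans hlo) hw
    · refine ⟨?_, hlo, hhi⟩
      rcases ha with ha | ha
      · exact ha
      · rcases hb with hb | hb
        · exact hb
        · have := sideVec_injective hθ (add_left_cancel (ha.trans hb.symm))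
          exact absurd this hlt.ne'
  · rw [Equiv.Perm.one_apply] at hhi
    rw [hhi] at hlt
    exact absurd hlt (Fin.not_lt_zero _)

lemma isTopPerimeter_mk [NeZero n] (θ : Fin n → ℝ) (w : Equiv.Perm (Fin n)) (h : 0 < w 0) :
    IsTopPerimeter θ w ⟨0, 0, w 0, h⟩ := by
  rw [IsTopPerimeter, pathSide_zero, pathSide_zero]
  exact ⟨Or.inl rfl, Or.inr (Or.inl rfl)⟩

/-- In a tiling, the first side of the leftside boundary belongs to a tile at the top vertex. -/
lemma IsQuasiTiling.exists_top_tile [NeZero n] (hθ : IsDirections θ) {w : Equiv.Perm (Fin n)}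
    {T : Finset (Tile n)} (hT : IsQuasiTiling θ w T)
    (hcov : leftBoundary θ ⊆ ⋃ t ∈ T, t.region θ) :
    ∃ t ∈ T, t.top = 0 ∧ t.lo = 0 ∧ t.hi ≤ w 0 := by
  have hn : 0 < n := NeZero.pos n
  obtain ⟨t, ht, h0, δ, hδ, -, hmem⟩ := Tile.exists_mem_region_of_ray hθ T (p := 0)
    (v := sideVec θ 0) one_pos fun δ hδ hδ' => by
      refine hcov (Set.mem_iUnion.2 ⟨0, ?_⟩)
      rw [pathSide_zero, segment_eq_image']
      exact ⟨δ, ⟨hδ.le, hδ'.le⟩, by simp⟩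
  have htop : t.top = 0 := by
    have h1 := (t.mem_region hθ 0).1 h0
    have h2 := t.loDrop_add_hiDrop hθ 0
    have h3 := ((mem_polygon hθ hn w _).1 (hT.region_subset ht t.top_mem_region)).1
    rw [Complex.zero_im] at h2
    have h4 := t.eq_top_add hθ 0
    rw [show t.loDrop θ 0 = 0 by linarith [h1.1.1, h1.2.1],
      show t.hiDrop θ 0 = 0 by linarith [h1.1.1, h1.2.1]] at h4
    simpa using h4.symm
  refine ⟨t, ht, htop, ?_, ?_⟩
  -- Direction `0` is the leftmost, so a tile at the top with both labels larger contains no other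
  -- point of that side.
  · by_contra hlo
    have hpos := Fin.pos_iff_ne_zero.2 hlo
    have s1 := slope_strictMono hθ hpos
    have s2 := slope_strictMono hθ (hpos.trans t.lo_lt_hi)
    have h1 := (t.mem_region hθ _).1 hmem
    have h2 := t.loDrop_add_hiDrop hθ (0 + δ • sideVec θ 0)
    have h3 := t.slope_mul_add hθ (0 + δ • sideVec θ 0)
    simp [htop, sideVec_im, sideVec_re hθ] at h1 h2 h3
    generalize t.loDrop θ _ = α at h1 h2 h3
    generalize t.hiDrop θ _ = β at h1 h2 h3
    have h4 := mul_pos hδ (drop_pos hθ 0)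
    have h5 := mul_nonneg (sub_nonneg.2 s1.le) h1.1.1
    have h6 := mul_nonneg (sub_nonneg.2 s2.le) h1.2.1
    have h7 : slope θ 0 * (α + β) = slope θ 0 * (δ * drop θ 0) := by rw [h2]
    rcases h1.1.1.eq_or_lt with e | e
    · have h8 := mul_pos (sub_pos.2 s2) (show 0 < β by linarith)
      linarith
    · have h8 := mul_pos (sub_pos.2 s1) e
      linarith
  · by_contra! hlt
    have s1 := slope_strictMono hθ hlt
    have hd1 := drop_pos hθ t.hi
    have hd2 := drop_pos hθ (w 0)
    -- At depth `u` both the `hi` edge and the first right side are still present, and the edge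
    -- would lie outside the polygon.
    set u := min (drop θ t.hi) (drop θ (w 0))
    have hu : 0 < u := lt_min hd1 hd2
    have hu1 : u ≤ drop θ t.hi := min_le_left _ _
    have hu2 : u ≤ drop θ (w 0) := min_le_right _ _
    have hp := hT.region_subset ht (show t.top + (0 : ℝ) • sideVec θ t.lo +
      (u / drop θ t.hi) • sideVec θ t.hi ∈ t.region θ from
        ⟨0, by simp, _, ⟨div_nonneg hu.le hd1.le, (div_le_one hd1).2 hu1⟩, rfl⟩)
    have hs := depth_succ θ w 0
    rw [mem_polygon hθ hn] at hp
    have him : -(t.top + (0 : ℝ) • sideVec θ t.lo +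
      (u / drop θ t.hi) • sideVec θ t.hi).im = u := by
      simp [htop, sideVec_im]
      field_simp
    have hre : (t.top + (0 : ℝ) • sideVec θ t.lo +
      (u / drop θ t.hi) • sideVec θ t.hi).re = slope θ t.hi * u := by
      simp [htop, sideVec_re hθ]
      field_simp
    rw [him, hre] at hp
    have h0 : depth θ w ((0 : Fin n) : ℕ) = 0 := by rw [Fin.val_zero, depth_zero]
    rw [profile_eq hθ w (i := 0) (by rw [h0]; exact hu.le) (by rw [hs, h0]; linarith), h0,
      Fin.val_zero, pathVertex_zero, Complex.zero_re] at hp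
    nlinarith [hp.2.2.2]

lemma isForcedTopPerimeter_mk [NeZero n] (hθ : IsDirections θ) {w : Equiv.Perm (Fin n)}
    (h : 0 < w 0) (hw : ¬Together321 w (w 0) 0) :
    IsForcedTopPerimeter θ w ⟨0, 0, w 0, h⟩ := by
  refine fun T hT => ⟨?_, isTopPerimeter_mk θ w h⟩
  have hT' := hT.isQuasiTiling hθ (NeZero.pos n)
  obtain ⟨⟨_, lo, hi, hlt⟩, ht, htop, hlo, hle⟩ := hT'.exists_top_tile hθ (by
    rw [hT.1]
    exact leftBoundary_subset_polygon hθ (NeZero.pos n) w)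
  have hinv := hT'.symm_hi_lt_symm_lo hθ ht
  simp only at htop hlo hle hinv
  subst htop hlo
  obtain rfl : hi = w 0 := by
    by_contra hne
    exact hw (together321_of_lt hlt (lt_of_le_of_ne hle hne) hinv)
  exact ht

end

end Elnitsky

theorem theorem4 (n : ℕ) [NeZero n] (hn : 2 ≤ n) (θ : Fin n → ℝ) (hθ : Elnitsky.IsDirections θ)
    (w : Equiv.Perm (Fin n)) (hw : Elnitsky.FullySupported w) :
    ((∃ t : Elnitsky.Tile n, Elnitsky.IsForcedTopPerimeter θ w t) ↔
        ¬ Elnitsky.Together321 w (w 0) 0) ∧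
      (∀ t : Elnitsky.Tile n, Elnitsky.IsForcedTopPerimeter θ w t → t.labels = {0, w 0}) ∧
      (¬ Elnitsky.Together321 w (w 0) 0 ↔ Elnitsky.FirstLRMinAfterFirstIs w 0) := by
  have h0 := hw.apply_zero_ne hn
  refine ⟨⟨?_, fun h => ⟨_, Elnitsky.isForcedTopPerimeter_mk hθ (Fin.pos_iff_ne_zero.2 h0) h⟩⟩, ?_,
    Elnitsky.not_together321_iff h0⟩
  · rintro ⟨t, ht⟩ h
    obtain ⟨b, hb0, hb, hlt⟩ := h.exists_lt
    obtain ⟨T, hT, hav⟩ := Elnitsky.IsQuasiTiling.exists_avoiding hθ w hb0 hb hlt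
    obtain ⟨htT, hper⟩ := ht T (hT.isRhombicTiling hθ hn hw)
    obtain ⟨h1, h2, h3⟩ := hper.top_lo_hi hθ h0
    exact hav t htT h1 h2 h3
  · intro t ht
    -- Being forced would be vacuous without a tiling, so one must be exhibited.
    obtain ⟨T, hT⟩ := Elnitsky.IsQuasiTiling.exists_of_pos hθ (by omega) w
    obtain ⟨-, h2, h3⟩ := (ht T (hT.isRhombicTiling hθ hn hw)).2.top_lo_hi hθ h0
    rw [Elnitsky.Tile.labels, h2, h3]
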